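/- **Conventions.** All spaces are complex. Let $\mathbb T=\mathbb R/\mathbb Z$ carry its normalised Haar measure, put $e_n(t)=e^{2\pi i n t}$, and for a Banach space $X$ let $\mathscr P(\mathbb T;X)$ be the set of trigonometric polynomials $f=\sum_{n\in\mathbb Z}a_ne_n$ with $(a_n)_{n\in\mathbb Z}$ a finitely supported sequence in $X$. For $I\subseteq\mathbb Z$ put $D_If=\sum_{n\in I}a_ne_n$. A Banach space $X$ is a *UMD space* if for every $p\in(1,\infty)$ there is a constant $C$ such that $\|D_{\{n\ge 0\}}f\|_{L^p(\mathbb T;X)}\le C\|f\|_{L^p(\mathbb T;X)}$ for all $f\in\mathscr P(\mathbb T;X)$ (boundedness of the Riesz projection, a well-known characterisation of UMD that is taken as the definition here). For $p,q\in[1,\infty]$ the space $X$ has *upper $\ell^q(L^p)$-decompositions* if there is a constant $U>0$ such that for every partition $\mathcal I$ of $\mathbb Z$ into intervals and all $f\in\mathscr P(\mathbb T;X)$ $$\|f\|_{L^p(\mathbb T;X)}\le U\Big(\sum_{I\in\mathcal I}\|D_If\|_{L^p(\mathbb T;X)}^q\Big)^{1/q},$$ and *lower $\ell^q(L^p)$-decompositions*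 if there is a constant $L>0$ such that for all such $\mathcal I$ and $f$ $$\Big(\sum_{I\in\mathcal I}\|D_If\|_{L^p(\mathbb T;X)}^q\Big)^{1/q}\le L\,\|f\|_{L^p(\mathbb T;X)},$$ with the supremum over $I\in\mathcal I$ in place of the sum if $q=\infty$. An *interpolation couple* $(X_0,X_1)$ consists of two Banach spaces that are continuously embedded in a common Hausdorff topological vector space; $X_0+X_1$ has the norm $\|x\|=\inf\{\|x_0\|_{X_0}+\|x_1\|_{X_1}:x=x_0+x_1\}$. For $\theta\in(0,1)$ the complex interpolation space $[X_0,X_1]_\theta$ consists of the values $x=f(\theta)$ of the bounded continuous functions $f:\{0\le\operatorname{Re}z\le1\}\to X_0+X_1$ that are holomorphic on $\{0<\operatorname{Re}z<1\}$ and for which $t\mapsto f(j+it)$ is a bounded continuous function from $\mathbb R$ to $X_j$, $j=0,1$; its norm is $\|x\|=\inf\max_{j=0,1}\sup_{t\in\mathbb R}\|f(j+it)\|_{X_j}$, where the infimum is taken over all such $f$ with $f(\theta)=x$. The conjugate exponent of $p\in[1,\infty]$ is $p'$, with $\frac1p+\frac1{p'}=1$. **Statement.** (A) *Interpolation.* Let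 $(X_0,X_1)$ be an interpolation couple of UMD spaces. Let $p_0,p_1\in(1,\infty)$, $q_0,q_1\in[1,\infty]$ and $\theta\in(0,1)$, set $X_\theta=[X_0,X_1]_\theta$ and $$\frac1p=\frac{1-\theta}{p_0}+\frac{\theta}{p_1},\qquad \frac1q=\frac{1-\theta}{q_0}+\frac{\theta}{q_1}.$$ If $X_i$ has upper $\ell^{q_i}(L^{p_i})$-decompositions for $i=0,1$, then $X_\theta$ has upper $\ell^q(L^p)$-decompositions. If $X_i$ has lower $\ell^{q_i}(L^{p_i})$-decompositions for $i=0,1$, then $X_\theta$ has lower $\ell^q(L^p)$-decompositions. (B) *Extrapolation.* Let $X$ be a UMD space and let $p,q\in(1,\infty)$. 1. If $X$ has upper $\ell^q(L^p)$-decompositions, then $X$ has upper $\ell^s(L^r)$-decompositions for all $s\in[1,q)$ and $r\in(1,\infty)$ such that $s'=\frac{q'}{\theta}$ for some $\theta\ge0$ with $\theta<\min\{\frac pr,\frac{p'}{r'}\}$. 2. If $X$ has lower $\ell^q(L^p)$-decompositions, then $X$ has lower $\ell^s(L^r)$-decompositions for all $s\in(q,\infty]$ and $r\in(1,\infty)$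 such that $s=\frac q\theta$ for some $\theta\ge0$ with $\theta<\min\{\frac pr,\frac{p'}{r'}\}$. Here $\frac{q'}{0}=\frac q0=\infty$, so that $\theta=0$ corresponds to $s=1$ in 1. and to $s=\infty$ in 2. -/

import Mathlib

open MeasureTheory Complex
open scoped ENNReal NNReal BoundedContinuousFunction

noncomputable section

/-! ### Trigonometric polynomials and decompositions of Fourier series -/

section Decompositions

variable {X : Type*} [NormedAddCommGroup X] [NormedSpace ℂ X]

/-- The trigonometric polynomial `∑ n, a n • e_n` on `𝕋 = ℝ / ℤ`, with `e_n t = exp (2 π i n t)`,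
whose Fourier coefficients are the finitely supported sequence `a` in `X`. -/
def trigPoly (a : ℤ →₀ X) : UnitAddCircle → X :=
  fun t => a.sum fun n x => fourier n t • x

open scoped Classical in
/-- The Fourier multiplier with symbol the indicator function of `I`, applied to the trigonometric
polynomial with Fourier coefficients `a`; this is `D_I f` for `f = trigPoly a`. -/
def trigProj (I : Set ℤ) (a : ℤ →₀ X) : UnitAddCircle → X :=
  trigPoly (a.filter (· ∈ I))

/-- The norm of `f` in `L^p(𝕋; X)`, where `𝕋` carries the normalised Haar measure. -/
def torusLpNorm (p : ℝ≥0∞) (f : UnitAddCircle → X) : ℝ≥0∞ :=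
  eLpNorm f p AddCircle.haarAddCircle

variable (X) in
/-- UMD spaces, defined by the boundedness of the Riesz projection (the Fourier multiplier with
symbol the indicator function of `[0, ∞)`) on `L^p(𝕋; X)` for `1 < p < ∞`. -/
def IsUMD : Prop :=
  ∀ p : ℝ≥0∞, 1 < p → p < ∞ → ∃ C : ℝ≥0, ∀ a : ℤ →₀ X,
    torusLpNorm p (trigProj (Set.Ici 0) a) ≤ C * torusLpNorm p (trigPoly a)

/-- A partition of `ℤ` into intervals. -/
def IsIntervalPartition (P : Set (Set ℤ)) : Prop :=
  Setoid.IsPartition P ∧ ∀ I ∈ P, I.OrdConnected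

/-- The `ℓ^q` norm of a family of extended non-negative numbers, for `1 ≤ q ≤ ∞`. -/
def seqNorm {ι : Type*} (q : ℝ≥0∞) (x : ι → ℝ≥0∞) : ℝ≥0∞ :=
  if q = ∞ then ⨆ i, x i else (∑' i, x i ^ q.toReal) ^ (1 / q.toReal)

variable (X) in
/-- `X` has upper `ℓ^q(L^p)`-decompositions. -/
def HasUpperDecompositions (q p : ℝ≥0∞) : Prop :=
  ∃ U : ℝ≥0, 0 < U ∧ ∀ P : Set (Set ℤ), IsIntervalPartition P → ∀ a : ℤ →₀ X,
    torusLpNorm p (trigPoly a) ≤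
      U * seqNorm q (fun I : P => torusLpNorm p (trigProj (I : Set ℤ) a))

variable (X) in
/-- `X` has lower `ℓ^q(L^p)`-decompositions. -/
def HasLowerDecompositions (q p : ℝ≥0∞) : Prop :=
  ∃ L : ℝ≥0, 0 < L ∧ ∀ P : Set (Set ℤ), IsIntervalPartition P → ∀ a : ℤ →₀ X,
    seqNorm q (fun I : P => torusLpNorm p (trigProj (I : Set ℤ) a)) ≤
      L * torusLpNorm p (trigPoly a)

end Decompositions

/-! ### Complex interpolation -/

/-- An interpolation couple: two normed spaces that are continuously embedded into a common
Hausdorff topological vector space `V`. -/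
structure InterpolationCouple (X₀ X₁ V : Type*)
    [NormedAddCommGroup X₀] [NormedSpace ℂ X₀] [NormedAddCommGroup X₁] [NormedSpace ℂ X₁]
    [AddCommGroup V] [Module ℂ V] [TopologicalSpace V] where
  /-- the embedding of the first space -/
  emb₀ : X₀ →L[ℂ] V
  /-- the embedding of the second space -/
  emb₁ : X₁ →L[ℂ] V
  emb₀_injective : Function.Injective emb₀
  emb₁_injective : Function.Injective emb₁

namespace InterpolationCouple

variable {X₀ X₁ V : Type*}
  [NormedAddCommGroup X₀] [NormedSpace ℂ X₀] [NormedAddCommGroup X₁] [NormedSpace ℂ X₁]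
  [AddCommGroup V] [Module ℂ V] [TopologicalSpace V]
  [IsTopologicalAddGroup V] [T2Space V]

/-- The addition map `X₀ ⊕₁ X₁ → V`, `(x₀, x₁) ↦ x₀ + x₁`. -/
def addMap (c : InterpolationCouple X₀ X₁ V) : WithLp 1 (X₀ × X₁) →L[ℂ] V :=
  (c.emb₀.coprod c.emb₁).comp (WithLp.prodContinuousLinearEquiv 1 ℂ X₀ X₁).toContinuousLinearMap

/-- The kernel of the addition map. -/
def addKer (c : InterpolationCouple X₀ X₁ V) : Submodule ℂ (WithLp 1 (X₀ × X₁)) :=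
  LinearMap.ker c.addMap.toLinearMap

instance isClosed_addKer (c : InterpolationCouple X₀ X₁ V) :
    IsClosed (c.addKer : Set (WithLp 1 (X₀ × X₁))) :=
  c.addMap.isClosed_ker

/-- The sum `X₀ + X₁` with the norm `inf {‖x₀‖ + ‖x₁‖ : x = x₀ + x₁}`. It is realised as the
quotient of the `ℓ¹`-direct sum by the kernel of the addition map, which addition maps
bijectively onto the subspace `X₀ + X₁` of `V`. -/
abbrev SumSpace (c : InterpolationCouple X₀ X₁ V) : Type _ :=
  WithLp 1 (X₀ × X₁) ⧸ c.addKer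

/-- The inclusion of `X₀` in `X₀ + X₁`. -/
def incl₀ (c : InterpolationCouple X₀ X₁ V) : X₀ →ₗ[ℂ] c.SumSpace :=
  c.addKer.mkQ ∘ₗ (WithLp.linearEquiv 1 ℂ (X₀ × X₁)).symm.toLinearMap ∘ₗ LinearMap.inl ℂ X₀ X₁

/-- The inclusion of `X₁` in `X₀ + X₁`. -/
def incl₁ (c : InterpolationCouple X₀ X₁ V) : X₁ →ₗ[ℂ] c.SumSpace :=
  c.addKer.mkQ ∘ₗ (WithLp.linearEquiv 1 ℂ (X₀ × X₁)).symm.toLinearMap ∘ₗ LinearMap.inr ℂ X₀ X₁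

theorem norm_incl₀_le (c : InterpolationCouple X₀ X₁ V) (x : X₀) : ‖c.incl₀ x‖ ≤ ‖x‖ := by
  refine (Submodule.Quotient.norm_mk_le c.addKer (WithLp.toLp 1 (x, (0 : X₁)))).trans ?_
  simp

theorem norm_incl₁_le (c : InterpolationCouple X₀ X₁ V) (x : X₁) : ‖c.incl₁ x‖ ≤ ‖x‖ := by
  refine (Submodule.Quotient.norm_mk_le c.addKer (WithLp.toLp 1 ((0 : X₀), x))).trans ?_
  simp

/-- The functions of the complex method: `f` is bounded and continuous on the strip
`0 ≤ re z ≤ 1` with values in `X₀ + X₁`, holomorphic inside, and its boundary values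
`t ↦ f (i t)` and `t ↦ f (1 + i t)` are bounded continuous functions `g₀`, `g₁` with values in
`X₀` and `X₁`. The values of `f` outside of the strip are irrelevant. -/
structure IsAdmissible (c : InterpolationCouple X₀ X₁ V) (f : ℂ → c.SumSpace)
    (g₀ : ℝ →ᵇ X₀) (g₁ : ℝ →ᵇ X₁) : Prop where
  continuousOn : ContinuousOn f (re ⁻¹' Set.Icc 0 1)
  differentiableOn : DifferentiableOn ℂ f (re ⁻¹' Set.Ioo 0 1)
  bounded : ∃ C : ℝ, ∀ z : ℂ, 0 ≤ z.re → z.re ≤ 1 → ‖f z‖ ≤ C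
  left : ∀ t : ℝ, f (t * I) = c.incl₀ (g₀ t)
  right : ∀ t : ℝ, f (1 + t * I) = c.incl₁ (g₁ t)

theorem IsAdmissible.zero (c : InterpolationCouple X₀ X₁ V) :
    c.IsAdmissible 0 0 0 where
  continuousOn := continuousOn_const
  differentiableOn := differentiableOn_const _
  bounded := ⟨0, by simp⟩
  left := by simp
  right := by simp

theorem IsAdmissible.add {c : InterpolationCouple X₀ X₁ V} {f f' : ℂ → c.SumSpace}
    {g₀ g₀' : ℝ →ᵇ X₀} {g₁ g₁' : ℝ →ᵇ X₁}
    (h : c.IsAdmissible f g₀ g₁) (h' : c.IsAdmissible f' g₀' g₁') :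
    c.IsAdmissible (f + f') (g₀ + g₀') (g₁ + g₁') where
  continuousOn := h.continuousOn.add h'.continuousOn
  differentiableOn := h.differentiableOn.add h'.differentiableOn
  bounded := by
    obtain ⟨C, hC⟩ := h.bounded
    obtain ⟨C', hC'⟩ := h'.bounded
    exact ⟨C + C', fun z h0 h1 => (norm_add_le _ _).trans (add_le_add (hC z h0 h1) (hC' z h0 h1))⟩
  left t := by simp [h.left, h'.left]
  right t := by simp [h.right, h'.right]

theorem IsAdmissible.smul {c : InterpolationCouple X₀ X₁ V} {f : ℂ → c.SumSpace}
    {g₀ : ℝ →ᵇ X₀} {g₁ : ℝ →ᵇ X₁} (r : ℂ) (h : c.IsAdmissible f g₀ g₁) :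
    c.IsAdmissible (r • f) (r • g₀) (r • g₁) where
  continuousOn := h.continuousOn.const_smul r
  differentiableOn := h.differentiableOn.const_smul r
  bounded := by
    obtain ⟨C, hC⟩ := h.bounded
    refine ⟨‖r‖ * C, fun z h0 h1 => ?_⟩
    rw [Pi.smul_apply, norm_smul]
    exact mul_le_mul_of_nonneg_left (hC z h0 h1) (norm_nonneg r)
  left t := by simp [h.left]
  right t := by simp [h.right]

/-- The three lines lemma: an admissible function is bounded by its boundary values. -/
theorem IsAdmissible.norm_le {c : InterpolationCouple X₀ X₁ V} {f : ℂ → c.SumSpace}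
    {g₀ : ℝ →ᵇ X₀} {g₁ : ℝ →ᵇ X₁} (h : c.IsAdmissible f g₀ g₁) {z : ℂ}
    (h0 : 0 ≤ z.re) (h1 : z.re ≤ 1) : ‖f z‖ ≤ max ‖g₀‖ ‖g₁‖ := by
  have hcl : closure (re ⁻¹' Set.Ioo (0 : ℝ) 1) = re ⁻¹' Set.Icc (0 : ℝ) 1 := by
    rw [closure_preimage_re, closure_Ioo zero_ne_one]
  refine PhragmenLindelof.vertical_strip (a := 0) (b := 1)
    ⟨h.differentiableOn, hcl ▸ h.continuousOn⟩ ?_ ?_ ?_ h0 h1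
  · obtain ⟨C, hC⟩ := h.bounded
    refine ⟨0, by simpa using Real.pi_pos, 0, ?_⟩
    refine Asymptotics.IsBigO.of_bound C ?_
    filter_upwards [Filter.mem_inf_of_right (Filter.mem_principal_self _)] with w hw
    simpa using hC w hw.1.le hw.2.le
  · intro w hw
    have : w = (w.im : ℂ) * I := by apply Complex.ext <;> simp [hw]
    rw [this, h.left]
    exact ((c.norm_incl₀_le _).trans (g₀.norm_coe_le_norm _)).trans (le_max_left _ _)
  · intro w hw
    have : w = 1 + (w.im : ℂ) * I := by apply Complex.ext <;> simp [hw]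
    rw [this, h.right]
    exact ((c.norm_incl₁_le _).trans (g₁.norm_coe_le_norm _)).trans (le_max_right _ _)

/-- The elements of the complex interpolation space `[X₀, X₁]_θ`, as a subspace of `X₀ + X₁`:
the values `f θ` of admissible functions. -/
def interpSubmodule (c : InterpolationCouple X₀ X₁ V) (θ : Set.Ioo (0 : ℝ) 1) :
    Submodule ℂ c.SumSpace where
  carrier := {x | ∃ f g₀ g₁, c.IsAdmissible f g₀ g₁ ∧ f ((θ : ℝ) : ℂ) = x}
  zero_mem' := ⟨0, 0, 0, IsAdmissible.zero c, rfl⟩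
  add_mem' := by
    rintro x y ⟨f, g₀, g₁, h, rfl⟩ ⟨f', g₀', g₁', h', rfl⟩
    exact ⟨_, _, _, h.add h', rfl⟩
  smul_mem' := by
    rintro r x ⟨f, g₀, g₁, h, rfl⟩
    exact ⟨_, _, _, h.smul r, rfl⟩

/-- The complex interpolation space `[X₀, X₁]_θ`. It is a type synonym of `interpSubmodule`, so
that it does not inherit the norm of `X₀ + X₁`. -/
def InterpSpace (c : InterpolationCouple X₀ X₁ V) (θ : Set.Ioo (0 : ℝ) 1) : Type _ :=
  c.interpSubmodule θ

namespace InterpSpace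

variable {c : InterpolationCouple X₀ X₁ V} {θ : Set.Ioo (0 : ℝ) 1}

instance : AddCommGroup (c.InterpSpace θ) := inferInstanceAs (AddCommGroup (c.interpSubmodule θ))

instance : Module ℂ (c.InterpSpace θ) := inferInstanceAs (Module ℂ (c.interpSubmodule θ))

/-- The inclusion of `[X₀, X₁]_θ` in `X₀ + X₁`. -/
def incl (c : InterpolationCouple X₀ X₁ V) (θ : Set.Ioo (0 : ℝ) 1) :
    c.InterpSpace θ →ₗ[ℂ] c.SumSpace :=
  (c.interpSubmodule θ).subtype

/-- The numbers `max (sup_t ‖f (i t)‖_{X₀}) (sup_t ‖f (1 + i t)‖_{X₁})`, for `f` admissible with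
`f θ = x`. -/
def normSet (x : c.InterpSpace θ) : Set ℝ :=
  {M | ∃ f g₀ g₁, c.IsAdmissible f g₀ g₁ ∧ f ((θ : ℝ) : ℂ) = incl c θ x ∧ M = max ‖g₀‖ ‖g₁‖}

/-- The norm of `[X₀, X₁]_θ` is the infimum of these numbers. -/
instance : Norm (c.InterpSpace θ) where
  norm x := sInf (normSet x)

theorem norm_def (x : c.InterpSpace θ) : ‖x‖ = sInf (normSet x) := rfl

theorem normSet_nonempty (x : c.InterpSpace θ) : (normSet x).Nonempty := by
  obtain ⟨f, g₀, g₁, h, hx⟩ := x.2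
  exact ⟨_, f, g₀, g₁, h, hx, rfl⟩

theorem norm_incl_le_of_mem {x : c.InterpSpace θ} {M : ℝ} (hM : M ∈ normSet x) :
    ‖incl c θ x‖ ≤ M := by
  obtain ⟨f, g₀, g₁, h, hx, rfl⟩ := hM
  rw [← hx]
  exact h.norm_le (by simpa using θ.2.1.le) (by simpa using θ.2.2.le)

theorem normSet_bddBelow (x : c.InterpSpace θ) : BddBelow (normSet x) :=
  ⟨_, fun _ hM => norm_incl_le_of_mem hM⟩

theorem norm_incl_le (x : c.InterpSpace θ) : ‖incl c θ x‖ ≤ ‖x‖ :=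
  le_csInf (normSet_nonempty x) fun _ hM => norm_incl_le_of_mem hM

theorem norm_le_of_mem {x : c.InterpSpace θ} {M : ℝ} (hM : M ∈ normSet x) : ‖x‖ ≤ M :=
  csInf_le (normSet_bddBelow x) hM

theorem norm_zero_eq : ‖(0 : c.InterpSpace θ)‖ = 0 := by
  refine le_antisymm (norm_le_of_mem ⟨0, 0, 0, IsAdmissible.zero c, by simp, by simp⟩) ?_
  simpa using (norm_nonneg _).trans (norm_incl_le (0 : c.InterpSpace θ))

theorem norm_smul_le_mul (r : ℂ) (x : c.InterpSpace θ) : ‖r • x‖ ≤ ‖r‖ * ‖x‖ := by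
  rw [norm_def x, ← smul_eq_mul, ← Real.sInf_smul_of_nonneg (norm_nonneg r)]
  refine le_csInf (normSet_nonempty x).smul_set ?_
  rintro _ ⟨_, ⟨f, g₀, g₁, h, hx, rfl⟩, rfl⟩
  refine norm_le_of_mem ⟨_, _, _, h.smul r, by simp [hx], ?_⟩
  simp only [norm_smul, smul_eq_mul]
  exact mul_max_of_nonneg _ _ (norm_nonneg r)

theorem norm_add_le_add (x y : c.InterpSpace θ) : ‖x + y‖ ≤ ‖x‖ + ‖y‖ := by
  refine le_of_forall_pos_le_add fun ε hε => ?_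
  obtain ⟨_, ⟨f, g₀, g₁, h, hx, rfl⟩, hlt⟩ :=
    Real.lt_sInf_add_pos (normSet_nonempty x) (half_pos hε)
  obtain ⟨_, ⟨f', g₀', g₁', h', hy, rfl⟩, hlt'⟩ :=
    Real.lt_sInf_add_pos (normSet_nonempty y) (half_pos hε)
  have key : ‖x + y‖ ≤ max ‖g₀ + g₀'‖ ‖g₁ + g₁'‖ :=
    norm_le_of_mem ⟨_, _, _, h.add h', by simp [hx, hy], rfl⟩
  have e₀ := norm_add_le g₀ g₀'
  have e₁ := norm_add_le g₁ g₁'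
  have m : max ‖g₀ + g₀'‖ ‖g₁ + g₁'‖ ≤ max ‖g₀‖ ‖g₁‖ + max ‖g₀'‖ ‖g₁'‖ :=
    max_le (e₀.trans (add_le_add (le_max_left _ _) (le_max_left _ _)))
      (e₁.trans (add_le_add (le_max_right _ _) (le_max_right _ _)))
  rw [← norm_def] at hlt hlt'
  linarith

theorem core (c : InterpolationCouple X₀ X₁ V) (θ : Set.Ioo (0 : ℝ) 1) :
    NormedSpace.Core ℂ (c.InterpSpace θ) where
  norm_nonneg x := (norm_nonneg _).trans (norm_incl_le x)
  norm_smul r x := (Seminorm.ofSMulLE (𝕜 := ℂ) (fun x : c.InterpSpace θ => ‖x‖)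
    norm_zero_eq norm_add_le_add norm_smul_le_mul).smul' r x
  norm_triangle := norm_add_le_add
  norm_eq_zero_iff x := by
    refine ⟨fun hx => ?_, fun hx => hx ▸ norm_zero_eq⟩
    have : incl c θ x = 0 := norm_le_zero_iff.1 (hx ▸ norm_incl_le x)
    exact Subtype.ext this

instance : NormedAddCommGroup (c.InterpSpace θ) := NormedAddCommGroup.ofCore (core c θ)

instance : NormedSpace ℂ (c.InterpSpace θ) := NormedSpace.ofCore (core c θ)

end InterpSpace

end InterpolationCouple

end

/-! Interpolation is carried out on boundary values. Trigonometric polynomials with coefficients in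
the space `Adm` of admissible functions form a common lift: `eval`, `left` and `right` act on
coefficients, hence commute with every `D_I`. Two facts about such lifts suffice.

Bounding (`exists_enorm_eval_le`): `‖f(θ)‖` is at most a constant times `A^(1-θ) B^θ`, where `A` and
`B` are Gaussian means of `‖f(iτ)‖` and `‖f(1+iτ)‖`. Applied pointwise on the torus and followed by
Hölder and Minkowski, first for `L^p` and then for `ℓ^q`, this bounds the `ℓ^q(L^p)` norm of the
values at `θ` by a common bound for the `ℓ^(q_j)(L^(p_j))` norms of the boundary values
(`exists_seqNorm_eval_le`).

Lifting (`exists_lift`): a polynomial with values in the interpolation space is recovered from its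
values at finitely many nodes by a de la Vallée-Poussin kernel. Each value is lifted separately to a
nearly optimal admissible function, rescaled by `r^(z-θ)`; the weights `r` from `exists_weight` turn
one `L^p` bound at `θ` into `L^(p_0)` and `L^(p_1)` bounds on the two sides.

For lower decompositions, lift `f`, decompose the boundary values, and bound the pieces at `θ`. For
upper decompositions, lift each `D_I f` with a weight depending on `I` that converts `ℓ^q` into
`ℓ^(q_0)` and `ℓ^(q_1)`. The lift may leave the frequency range `I`, so it is projected back, which
costs a constant because interval projections are uniformly bounded in UMD spaces. Then sum over
`I`, use the hypotheses on the boundary, and evaluate at `θ`.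

Extrapolation is interpolation for the couple `(X, X)`, which contains `X` isometrically at every
`θ`. One endpoint is the given decomposition, the other a trivial one: upper `ℓ^1` is the triangle
inequality, lower `ℓ^∞` the boundedness of interval projections. The condition on `θ` says precisely
that the exponent `r_1` required at the trivial endpoint lies in `(1, ∞)`. -/

noncomputable section

/-! ### Norms of families of extended non-negative numbers -/

section ExtNorm

variable {α β : Type*} [MeasurableSpace α] [MeasurableSpace β]

/-- The `L^q` norm of an extended non-negative function, with the supremum for `q = ∞`. -/
def extNorm (μ : Measure α) (q : ℝ≥0∞) (f : α → ℝ≥0∞) : ℝ≥0∞ :=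
  if q = ∞ then ⨆ x, f x else (∫⁻ x, f x ^ q.toReal ∂μ) ^ (1 / q.toReal)

theorem extNorm_top (μ : Measure α) (f : α → ℝ≥0∞) : extNorm μ ∞ f = ⨆ x, f x := by
  simp [extNorm]

theorem extNorm_of_ne_top (μ : Measure α) {q : ℝ≥0∞} (hq : q ≠ ∞) (f : α → ℝ≥0∞) :
    extNorm μ q f = (∫⁻ x, f x ^ q.toReal ∂μ) ^ (1 / q.toReal) := by
  simp [extNorm, hq]

theorem extNorm_mono (μ : Measure α) (q : ℝ≥0∞) {f g : α → ℝ≥0∞} (h : ∀ x, f x ≤ g x) :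
    extNorm μ q f ≤ extNorm μ q g := by
  unfold extNorm
  split_ifs
  · exact iSup_mono h
  · exact ENNReal.rpow_le_rpow (lintegral_mono fun x => ENNReal.rpow_le_rpow (h x) (by positivity))
      (by positivity)

theorem extNorm_const_mul (μ : Measure α) {q : ℝ≥0∞} (hq : 1 ≤ q) {c : ℝ≥0∞} (hc : c ≠ ∞)
    (f : α → ℝ≥0∞) : extNorm μ q (fun x => c * f x) = c * extNorm μ q f := by
  unfold extNorm
  split_ifs with h
  · rw [ENNReal.mul_iSup]
  · have hq0 : 0 < q.toReal := ENNReal.toReal_pos (by positivity) h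
    simp only [ENNReal.mul_rpow_of_nonneg _ _ hq0.le]
    rw [lintegral_const_mul' _ _ (ENNReal.rpow_ne_top_of_nonneg hq0.le hc),
      ENNReal.mul_rpow_of_nonneg _ _ (by positivity), ← ENNReal.rpow_mul,
      mul_one_div_cancel hq0.ne', ENNReal.rpow_one]

theorem toReal_pos_of_one_le {q : ℝ≥0∞} (hq : 1 ≤ q) (h : q ≠ ∞) : 0 < q.toReal :=
  ENNReal.toReal_pos (by positivity) h

/-- The relation between exponents in complex interpolation. -/
structure InterpExponent (θ : ℝ) (q₀ q₁ q : ℝ≥0∞) : Prop where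
  pos : 0 < θ
  lt_one : θ < 1
  one_le₀ : 1 ≤ q₀
  one_le₁ : 1 ≤ q₁
  eq : 1 / q = ENNReal.ofReal (1 - θ) / q₀ + ENNReal.ofReal θ / q₁

namespace InterpExponent

variable {θ : ℝ} {q₀ q₁ q : ℝ≥0∞}

theorem ne_zero₀ (h : InterpExponent θ q₀ q₁ q) : q₀ ≠ 0 :=
  (zero_lt_one.trans_le h.one_le₀).ne'

theorem ne_zero₁ (h : InterpExponent θ q₀ q₁ q) : q₁ ≠ 0 :=
  (zero_lt_one.trans_le h.one_le₁).ne'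

theorem eq_top_iff (h : InterpExponent θ q₀ q₁ q) : q = ∞ ↔ q₀ = ∞ ∧ q₁ = ∞ := by
  have h1 : ENNReal.ofReal (1 - θ) ≠ 0 := by simpa using h.lt_one
  have h2 : ENNReal.ofReal θ ≠ 0 := by simpa using h.pos
  have := h.eq
  rw [one_div] at this
  rw [← ENNReal.inv_eq_zero, this, add_eq_zero, ENNReal.div_eq_zero_iff, ENNReal.div_eq_zero_iff]
  simp [h1, h2]

/-- Real form of the exponent relation, valid for infinite exponents too because `∞.toReal⁻¹ = 0`.
-/
theorem inv_toReal (h : InterpExponent θ q₀ q₁ q) :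
    q.toReal⁻¹ = (1 - θ) * q₀.toReal⁻¹ + θ * q₁.toReal⁻¹ := by
  have := congrArg ENNReal.toReal h.eq
  rw [ENNReal.toReal_add (ENNReal.div_ne_top ENNReal.ofReal_ne_top h.ne_zero₀)
    (ENNReal.div_ne_top ENNReal.ofReal_ne_top h.ne_zero₁)] at this
  simpa [ENNReal.toReal_div, ENNReal.toReal_ofReal h.pos.le,
    ENNReal.toReal_ofReal (sub_nonneg.2 h.lt_one.le), div_eq_mul_inv] using this

theorem one_le (h : InterpExponent θ q₀ q₁ q) : 1 ≤ q := by
  have : 1 / q ≤ 1 := by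
    rw [h.eq]
    calc _ ≤ ENNReal.ofReal (1 - θ) / 1 + ENNReal.ofReal θ / 1 := by
            gcongr
            · exact h.one_le₀
            · exact h.one_le₁
      _ = 1 := by
            rw [div_one, div_one, ← ENNReal.ofReal_add (sub_nonneg.2 h.lt_one.le) h.pos.le]
            simp
  simpa using this

theorem symm (h : InterpExponent θ q₀ q₁ q) : InterpExponent (1 - θ) q₁ q₀ q where
  pos := sub_pos.2 h.lt_one
  lt_one := sub_lt_self _ h.pos
  one_le₀ := h.one_le₁
  one_le₁ := h.one_le₀
  eq := by rw [h.eq, add_comm, sub_sub_cancel]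

end InterpExponent

/-- The factor with exponent `∞` is replaced by its supremum; what remains is an identity, since
then `θ q = q₁`. -/
theorem extNorm_geomMean_le_of_top (μ : Measure α) {θ : ℝ} {q₁ q : ℝ≥0∞}
    (h : InterpExponent θ ∞ q₁ q) (hq₁ : q₁ ≠ ∞) (f g : α → ℝ≥0∞) (hg : Measurable g) :
    extNorm μ q (fun x => f x ^ (1 - θ) * g x ^ θ) ≤
      extNorm μ ∞ f ^ (1 - θ) * extNorm μ q₁ g ^ θ := by
  have hq : q ≠ ∞ := fun e => hq₁ (h.eq_top_iff.1 e).2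
  have hp := toReal_pos_of_one_le h.one_le hq
  have hp1 := toReal_pos_of_one_le h.one_le₁ hq₁
  have hr := h.inv_toReal
  have ht : θ * q.toReal = q₁.toReal := by
    simp only [ENNReal.toReal_top, inv_zero, mul_zero, zero_add] at hr
    field_simp at hr
    linarith
  have h1 : 0 ≤ 1 - θ := sub_nonneg.2 h.lt_one.le
  rw [extNorm_of_ne_top μ hq, extNorm_of_ne_top μ hq₁]
  set S := extNorm μ ∞ f with hS
  have hfS : ∀ x, f x ≤ S := fun x => by rw [hS, extNorm_top]; exact le_iSup f x
  calc (∫⁻ x, (f x ^ (1 - θ) * g x ^ θ) ^ q.toReal ∂μ) ^ (1 / q.toReal)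
      ≤ (∫⁻ x, (S ^ (1 - θ)) ^ q.toReal * g x ^ q₁.toReal ∂μ) ^ (1 / q.toReal) := by
        gcongr with x
        rw [ENNReal.mul_rpow_of_nonneg _ _ hp.le, ← ENNReal.rpow_mul (g x), ht]
        gcongr
        exact hfS x
    _ = S ^ (1 - θ) * ((∫⁻ x, g x ^ q₁.toReal ∂μ) ^ (1 / q₁.toReal)) ^ θ := by
        rw [lintegral_const_mul _ (hg.pow_const _), ENNReal.mul_rpow_of_nonneg _ _ (by positivity),
          ← ENNReal.rpow_mul, mul_one_div_cancel hp.ne', ENNReal.rpow_one,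
          ← ENNReal.rpow_mul, ← ht]
        congr 2
        field_simp [h.pos.ne']

/-- Hölder's inequality for the norms of geometric means. -/
theorem extNorm_geomMean_le (μ : Measure α) {θ : ℝ} {q₀ q₁ q : ℝ≥0∞}
    (h : InterpExponent θ q₀ q₁ q) (f g : α → ℝ≥0∞) (hf : Measurable f) (hg : Measurable g) :
    extNorm μ q (fun x => f x ^ (1 - θ) * g x ^ θ) ≤
      extNorm μ q₀ f ^ (1 - θ) * extNorm μ q₁ g ^ θ := by
  have h1 : 0 ≤ 1 - θ := sub_nonneg.2 h.lt_one.le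
  have h2 : 0 ≤ θ := h.pos.le
  by_cases hq₀ : q₀ = ∞
  · by_cases hq₁ : q₁ = ∞
    · have hq : q = ∞ := h.eq_top_iff.2 ⟨hq₀, hq₁⟩
      rw [hq₀, hq₁, hq, extNorm_top, extNorm_top, extNorm_top]
      refine iSup_le fun x => ?_
      gcongr
      · exact le_iSup f x
      · exact le_iSup g x
    · subst hq₀
      exact extNorm_geomMean_le_of_top μ h hq₁ f g hg
  · by_cases hq₁ : q₁ = ∞
    · subst hq₁
      have := extNorm_geomMean_le_of_top μ h.symm hq₀ g f hf
      rw [sub_sub_cancel] at this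
      simpa only [mul_comm] using this
    · have hq : q ≠ ∞ := fun e => hq₁ (h.eq_top_iff.1 e).2
      have hp := toReal_pos_of_one_le h.one_le hq
      have hp0 := toReal_pos_of_one_le h.one_le₀ hq₀
      have hp1 := toReal_pos_of_one_le h.one_le₁ hq₁
      have hr := h.inv_toReal
      rw [extNorm_of_ne_top μ hq, extNorm_of_ne_top μ hq₀, extNorm_of_ne_top μ hq₁]
      set p := q.toReal
      set p₀ := q₀.toReal
      set p₁ := q₁.toReal
      -- Hölder for `f^p₀` and `g^p₁`; the exponent relation multiplied by `p` says that these two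
      -- powers add up to `1`.
      have key := ENNReal.lintegral_mul_norm_pow_le (μ := μ) (f := fun x => f x ^ p₀)
        (g := fun x => g x ^ p₁) (p := (1 - θ) * p / p₀) (q := θ * p / p₁)
        (hf.pow_const _).aemeasurable (hg.pow_const _).aemeasurable (by positivity)
        (by positivity) (by
          have : p * p⁻¹ = 1 := mul_inv_cancel₀ hp.ne'
          rw [hr] at this
          exact Eq.trans (by ring) this)
      calc (∫⁻ x, (f x ^ (1 - θ) * g x ^ θ) ^ p ∂μ) ^ (1 / p)
          = (∫⁻ x, (f x ^ p₀) ^ ((1 - θ) * p / p₀) * (g x ^ p₁) ^ (θ * p / p₁) ∂μ) ^ (1 / p) := by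
            congr 2
            ext x
            rw [ENNReal.mul_rpow_of_nonneg _ _ hp.le, ← ENNReal.rpow_mul, ← ENNReal.rpow_mul,
              ← ENNReal.rpow_mul, ← ENNReal.rpow_mul, mul_div_cancel₀ _ hp0.ne',
              mul_div_cancel₀ _ hp1.ne']
        _ ≤ ((∫⁻ x, f x ^ p₀ ∂μ) ^ ((1 - θ) * p / p₀) *
              (∫⁻ x, g x ^ p₁ ∂μ) ^ (θ * p / p₁)) ^ (1 / p) := by gcongr
        _ = _ := by
            rw [ENNReal.mul_rpow_of_nonneg _ _ (by positivity), ← ENNReal.rpow_mul,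
              ← ENNReal.rpow_mul, ← ENNReal.rpow_mul, ← ENNReal.rpow_mul]
            congr 2 <;> field_simp

/-- Minkowski's integral inequality. -/
theorem extNorm_lintegral_le (μ : Measure α) (ν : Measure β) [SFinite μ] [SFinite ν] {q : ℝ≥0∞}
    (hq : 1 ≤ q) {a : α → β → ℝ≥0∞} (ha : Measurable (Function.uncurry a))
    (hfin : q ≠ ∞ → extNorm μ q (fun x => ∫⁻ y, a x y ∂ν) ≠ ∞) :
    extNorm μ q (fun x => ∫⁻ y, a x y ∂ν) ≤ ∫⁻ y, extNorm μ q (fun x => a x y) ∂ν := by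
  by_cases hqt : q = ∞
  · subst hqt
    simp only [extNorm_top]
    exact iSup_le fun x => lintegral_mono fun y => le_iSup (fun x => a x y) x
  replace hfin := hfin hqt
  simp only [extNorm_of_ne_top _ hqt] at hfin ⊢
  have hp : 1 ≤ q.toReal := by
    simpa using ENNReal.toReal_mono hqt hq
  set p := q.toReal
  have hA : Measurable fun x => ∫⁻ y, a x y ∂ν := ha.lintegral_prod_right'
  have hay : ∀ y, Measurable fun x => a x y := fun y => ha.comp measurable_prodMk_right
  have hax : ∀ x, Measurable fun y => a x y := fun x => ha.comp measurable_prodMk_left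
  rcases hp.eq_or_lt with hp1 | hp1
  · simp only [← hp1, ENNReal.rpow_one, div_one]
    rw [lintegral_lintegral_swap ha.aemeasurable]
  set A := fun x => ∫⁻ y, a x y ∂ν
  set J := ∫⁻ x, A x ^ p ∂μ
  have hconj : p.HolderConjugate (p / (p - 1)) := Real.HolderConjugate.conjExponent hp1
  have hp0 : 0 < p := by positivity
  have hJ : J ≠ ∞ := fun e => hfin (by
    rw [e, ENNReal.top_rpow_of_pos (by positivity)])
  rcases eq_or_ne J 0 with hJ0 | hJ0
  · change J ^ (1 / p) ≤ _
    rw [hJ0, ENNReal.zero_rpow_of_pos (by positivity)]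
    exact zero_le
  -- Split off one factor of `A^p = A * A^(p-1)`, exchange the integrals and apply Hölder in `x`.
  -- The factor `J^(1/p')` is cancelled at the end, which is where `J` must be finite and non-zero.
  have hJle : J ≤ (∫⁻ y, (∫⁻ x, a x y ^ p ∂μ) ^ (1 / p) ∂ν) * J ^ (1 / (p / (p - 1))) := by
    calc J = ∫⁻ x, ∫⁻ y, a x y * A x ^ (p - 1) ∂ν ∂μ := by
          refine lintegral_congr fun x => ?_
          rw [lintegral_mul_const _ (hax x)]
          change A x ^ p = A x * A x ^ (p - 1)
          nth_rewrite 1 [show p = 1 + (p - 1) by ring]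
          rw [ENNReal.rpow_add_of_nonneg _ _ zero_le_one (by linarith), ENNReal.rpow_one]
      _ = ∫⁻ y, ∫⁻ x, a x y * A x ^ (p - 1) ∂μ ∂ν :=
          lintegral_lintegral_swap
            (ha.mul ((hA.pow_const _).comp measurable_fst)).aemeasurable
      _ ≤ ∫⁻ y, (∫⁻ x, a x y ^ p ∂μ) ^ (1 / p) * J ^ (1 / (p / (p - 1))) ∂ν := by
          refine lintegral_mono fun y => ?_
          refine (ENNReal.lintegral_mul_le_Lp_mul_Lq μ hconj (hay y).aemeasurable
            (hA.pow_const (p - 1)).aemeasurable).trans_eq ?_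
          congr 3
          ext x
          rw [← ENNReal.rpow_mul]
          congr 1
          have : p - 1 ≠ 0 := by linarith
          field_simp
      _ = _ := by
          rw [lintegral_mul_const]
          have : Measurable (fun y => ∫⁻ x, a x y ^ p ∂μ) :=
            (ha.pow_const p).lintegral_prod_left'
          exact this.pow_const _
  have hJr : J = J ^ (1 / p) * J ^ (1 / (p / (p - 1))) := by
    rw [← ENNReal.rpow_add _ _ hJ0 hJ]
    have : 1 / p + 1 / (p / (p - 1)) = 1 := by field_simp; ring
    rw [this, ENNReal.rpow_one]
  nth_rewrite 1 [hJr] at hJle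
  refine (ENNReal.mul_le_mul_iff_left ?_ ?_).1 hJle
  · simp [ENNReal.rpow_eq_zero_iff, hJ0, hJ]
  · exact ENNReal.rpow_ne_top_of_nonneg (one_div_nonneg.2 hconj.symm.pos.le) hJ

/-- Change of density that equalises the norms in the definition of the interpolation norm. -/
theorem exists_weight (μ : Measure α) {θ : ℝ} {q₀ q₁ q : ℝ≥0∞} (h : InterpExponent θ q₀ q₁ q)
    {N : α → ℝ} (hN : ∀ x, 0 ≤ N x) {S : ℝ} (hS : 0 < S)
    (hNS : extNorm μ q (fun x => ENNReal.ofReal (N x)) ≤ ENNReal.ofReal S) :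
    ∃ c : α → ℝ, (∀ x, 0 < c x) ∧
      extNorm μ q₀ (fun x => ENNReal.ofReal (c x ^ (-θ) * N x)) ≤ ENNReal.ofReal S ∧
      extNorm μ q₁ (fun x => ENNReal.ofReal (c x ^ (1 - θ) * N x)) ≤ ENNReal.ofReal S := by
  by_cases hq : q = ∞
  · obtain ⟨rfl, rfl⟩ := h.eq_top_iff.1 hq
    subst hq
    exact ⟨fun _ => 1, fun _ => one_pos, by simpa using hNS, by simpa using hNS⟩
  have hp := toReal_pos_of_one_le h.one_le hq
  have hr := h.inv_toReal
  set p := q.toReal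
  have hint : ∫⁻ x, ENNReal.ofReal (N x / S) ^ p ∂μ ≤ 1 := by
    rw [extNorm_of_ne_top μ hq] at hNS
    have e : ∀ x, ENNReal.ofReal (N x / S) ^ p =
        (ENNReal.ofReal S)⁻¹ ^ p * ENNReal.ofReal (N x) ^ p := fun x => by
      rw [← ENNReal.mul_rpow_of_nonneg _ _ hp.le, ENNReal.ofReal_div_of_pos hS, mul_comm,
        div_eq_mul_inv]
    have hS' : ENNReal.ofReal S ≠ 0 := by simpa using hS
    have hSt : (ENNReal.ofReal S)⁻¹ ≠ ∞ := by simpa using hS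
    simp only [e]
    rw [lintegral_const_mul' _ _ (ENNReal.rpow_ne_top_of_nonneg hp.le hSt)]
    have := ENNReal.rpow_le_rpow hNS hp.le
    rw [← ENNReal.rpow_mul, one_div_mul_cancel hp.ne', ENNReal.rpow_one] at this
    calc _ ≤ (ENNReal.ofReal S)⁻¹ ^ p * ENNReal.ofReal S ^ p := by gcongr
      _ = 1 := by
        rw [← ENNReal.mul_rpow_of_nonneg _ _ hp.le, ENNReal.inv_mul_cancel hS'
          ENNReal.ofReal_ne_top, ENNReal.one_rpow]
  -- Both weighted functions will have the form `S (N/S)^(p/q')`, whose `q'`-th power integrates to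
  -- at most `S^q'`.
  have main : ∀ q' : ℝ≥0∞, 1 ≤ q' → ∀ M : α → ℝ,
      (∀ x, N x = 0 → M x = 0) → (∀ x, 0 < N x → M x = S * (N x / S) ^ (p * q'.toReal⁻¹)) →
      extNorm μ q' (fun x => ENNReal.ofReal (M x)) ≤ ENNReal.ofReal S := by
    intro q' hq' M hM0 hM1
    by_cases hqt : q' = ∞
    · subst hqt
      rw [extNorm_top]
      refine iSup_le fun x => ?_
      rcases (hN x).eq_or_lt with h0 | h0
      · simp [hM0 x h0.symm]
      · simp [hM1 x h0]
    · have hp' := toReal_pos_of_one_le hq' hqt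
      rw [extNorm_of_ne_top μ hqt]
      set p' := q'.toReal
      calc _ ≤ (∫⁻ x, ENNReal.ofReal S ^ p' * ENNReal.ofReal (N x / S) ^ p ∂μ) ^ (1 / p') := by
            gcongr with x
            rcases (hN x).eq_or_lt with h0 | h0
            · simp [hM0 x h0.symm, hp']
            · have hpos : 0 < N x / S := by positivity
              rw [hM1 x h0, ENNReal.ofReal_mul hS.le, ENNReal.mul_rpow_of_nonneg _ _ hp'.le,
                ENNReal.ofReal_rpow_of_pos (Real.rpow_pos_of_pos hpos _), ← Real.rpow_mul hpos.le,
                ENNReal.ofReal_rpow_of_pos hpos, mul_assoc, inv_mul_cancel₀ hp'.ne', mul_one]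
        _ ≤ (ENNReal.ofReal S ^ p' * 1) ^ (1 / p') := by
            rw [lintegral_const_mul' _ _ (ENNReal.rpow_ne_top_of_nonneg hp'.le
              ENNReal.ofReal_ne_top)]
            gcongr
        _ = _ := by
            rw [mul_one, ← ENNReal.rpow_mul, mul_one_div_cancel hp'.ne', ENNReal.rpow_one]
  -- With `c = (N/S)^γ`, the exponent relation gives `1 - θγ = p/q₀` and `1 + (1-θ)γ = p/q₁`.
  set γ := p * (q₁.toReal⁻¹ - q₀.toReal⁻¹)
  have hpr : p * ((1 - θ) * q₀.toReal⁻¹ + θ * q₁.toReal⁻¹) = 1 := by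
    rw [← hr, mul_inv_cancel₀ hp.ne']
  have hc : ∀ s x, 0 < N x → ((N x / S) ^ γ) ^ s * N x = S * (N x / S) ^ (γ * s + 1) := by
    intro s x hx
    have hpos : 0 < N x / S := by positivity
    rw [← Real.rpow_mul hpos.le, Real.rpow_add hpos, Real.rpow_one]
    field_simp
  -- Where `N` vanishes any positive weight will do; positivity is needed for the rescaling by
  -- powers.
  refine ⟨fun x => if N x = 0 then 1 else (N x / S) ^ γ, fun x => ?_, ?_, ?_⟩
  · dsimp only
    split_ifs with h0
    · exact one_pos
    · have := lt_of_le_of_ne (hN x) (Ne.symm h0)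
      positivity
  · refine main q₀ h.one_le₀ _ (fun x hx => by simp [hx]) fun x hx => ?_
    dsimp only
    rw [if_neg hx.ne', hc _ x hx]
    congr 2
    calc γ * (-θ) + 1 = γ * (-θ) + p * ((1 - θ) * q₀.toReal⁻¹ + θ * q₁.toReal⁻¹) := by rw [hpr]
      _ = _ := by ring
  · refine main q₁ h.one_le₁ _ (fun x hx => by simp [hx]) fun x hx => ?_
    dsimp only
    rw [if_neg hx.ne', hc _ x hx]
    congr 2
    calc γ * (1 - θ) + 1 = γ * (1 - θ) + p * ((1 - θ) * q₀.toReal⁻¹ + θ * q₁.toReal⁻¹) := by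
          rw [hpr]
      _ = _ := by ring

end ExtNorm

theorem seqNorm_eq_extNorm {ι : Type*} [MeasurableSpace ι] [DiscreteMeasurableSpace ι] (q : ℝ≥0∞)
    (x : ι → ℝ≥0∞) : seqNorm q x = extNorm Measure.count q x := by
  simp [seqNorm, extNorm, lintegral_count]

theorem torusLpNorm_eq_extNorm {X : Type*} [NormedAddCommGroup X] {p : ℝ≥0∞} (h1 : 1 ≤ p)
    (h2 : p ≠ ∞) (f : UnitAddCircle → X) :
    torusLpNorm p f = extNorm AddCircle.haarAddCircle p (fun t => ‖f t‖ₑ) := by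
  rw [torusLpNorm, eLpNorm_eq_lintegral_rpow_enorm_toReal (zero_lt_one.trans_le h1).ne' h2,
    extNorm_of_ne_top _ h2]

/-! ### The Cauchy transform in the right half-plane -/

section CauchyTransform

/-- The Cauchy transform of a density on the imaginary axis. -/
def cauchyTransform (φ : ℝ → ℝ) (z : ℂ) : ℂ :=
  ∫ σ : ℝ, (φ σ : ℂ) * (z - σ * I)⁻¹

variable {φ : ℝ → ℝ}

theorem norm_inv_sub_mul_I_le {z : ℂ} (hz : 0 < z.re) (σ : ℝ) : ‖(z - σ * I)⁻¹‖ ≤ z.re⁻¹ := by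
  rw [norm_inv]
  gcongr
  calc z.re = (z - σ * I).re := by simp
    _ ≤ ‖z - σ * I‖ := (le_abs_self _).trans (abs_re_le_norm _)

theorem sub_mul_I_ne_zero {z : ℂ} (hz : 0 < z.re) (σ : ℝ) : z - σ * I ≠ 0 := by
  intro h
  have := congrArg re h
  simp at this
  exact hz.ne' this

theorem continuous_inv_sub_mul_I {z : ℂ} (hz : 0 < z.re) :
    Continuous fun σ : ℝ => (z - σ * I)⁻¹ :=
  Continuous.inv₀ (by fun_prop) (sub_mul_I_ne_zero hz)

theorem integrable_cauchyTransform (hφ : Integrable φ) {z : ℂ} (hz : 0 < z.re) :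
    Integrable fun σ : ℝ => (φ σ : ℂ) * (z - σ * I)⁻¹ :=
  hφ.ofReal.mul_bdd (c := z.re⁻¹) (continuous_inv_sub_mul_I hz).aestronglyMeasurable
    (ae_of_all _ (norm_inv_sub_mul_I_le hz))

theorem norm_cauchyTransform_le (hφ : Integrable φ) (h0 : ∀ σ, 0 ≤ φ σ) {z : ℂ} (hz : 0 < z.re) :
    ‖cauchyTransform φ z‖ ≤ (∫ σ, φ σ) * z.re⁻¹ := by
  rw [← integral_mul_const]
  refine norm_integral_le_of_norm_le (hφ.mul_const _) (ae_of_all _ fun σ => ?_)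
  rw [norm_mul, Complex.norm_real, Real.norm_of_nonneg (h0 σ)]
  exact mul_le_mul_of_nonneg_left (norm_inv_sub_mul_I_le hz σ) (h0 σ)

theorem differentiableAt_cauchyTransform (hφ : Integrable φ) {z : ℂ} (hz : 0 < z.re) :
    DifferentiableAt ℂ (cauchyTransform φ) z := by
  have hre : ∀ w ∈ Metric.ball z (z.re / 2), z.re / 2 ≤ w.re := fun w hw => by
    have h1 : |(w - z).re| < z.re / 2 :=
      (abs_re_le_norm _).trans_lt (by simpa [dist_eq_norm] using hw)
    rw [sub_re] at h1
    linarith [(abs_lt.1 h1).1]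
  refine (hasDerivAt_integral_of_dominated_loc_of_deriv_le (μ := volume)
    (F := fun w (σ : ℝ) => (φ σ : ℂ) * (w - σ * I)⁻¹)
    (F' := fun w (σ : ℝ) => (φ σ : ℂ) * (-1 / (w - σ * I) ^ 2))
    (bound := fun σ => ‖φ σ‖ * ((z.re / 2)⁻¹ ^ 2))
    (Metric.ball_mem_nhds z (half_pos hz)) ?_ (integrable_cauchyTransform hφ hz) ?_ ?_
    (hφ.norm.mul_const _) ?_).2.differentiableAt
  · filter_upwards [Metric.ball_mem_nhds z (half_pos hz)] with w hw
    exact (integrable_cauchyTransform hφ ((half_pos hz).trans_le (hre w hw))).aestronglyMeasurable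
  · refine hφ.ofReal.aestronglyMeasurable.mul (Continuous.aestronglyMeasurable ?_)
    exact Continuous.div (by fun_prop) (by fun_prop)
      fun σ => pow_ne_zero _ (sub_mul_I_ne_zero hz σ)
  · refine ae_of_all _ fun σ w hw => ?_
    have hw' := hre w hw
    have hw0 : 0 < w.re := (half_pos hz).trans_le hw'
    rw [norm_mul, Complex.norm_real, neg_div, norm_neg, one_div, ← inv_pow, norm_pow]
    gcongr
    exact (norm_inv_sub_mul_I_le hw0 σ).trans (by gcongr)
  · refine ae_of_all _ fun σ w hw => ?_
    have hw0 : 0 < w.re := (half_pos hz).trans_le (hre w hw)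
    exact (((hasDerivAt_id w).sub_const _).inv (sub_mul_I_ne_zero hw0 σ)).const_mul _

theorem re_cauchyTransform (hφ : Integrable φ) {z : ℂ} (hz : 0 < z.re) :
    (cauchyTransform φ z).re = ∫ σ, φ σ * (z.re / (z.re ^ 2 + (z.im - σ) ^ 2)) := by
  rw [cauchyTransform, ← reCLM_apply, ← reCLM.integral_comp_comm (integrable_cauchyTransform hφ hz)]
  congr 1
  ext σ
  simp [normSq_apply, pow_two]

theorem re_cauchyTransform_nonneg (hφ : Integrable φ) (h0 : ∀ σ, 0 ≤ φ σ) {z : ℂ}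
    (hz : 0 < z.re) : 0 ≤ (cauchyTransform φ z).re := by
  rw [re_cauchyTransform hφ hz]
  exact integral_nonneg fun σ => mul_nonneg (h0 σ) (by positivity)

/-- The real part is an unnormalised Poisson integral. Its kernel is at least `1 / (2 re z)` on the
window `|σ - im z| ≤ re z`, which has length `2 re z`. -/
theorem le_re_cauchyTransform (hφ : Integrable φ) (h0 : ∀ σ, 0 ≤ φ σ) {z : ℂ} (hz : 0 < z.re)
    {m : ℝ} (hm : ∀ σ, |σ - z.im| ≤ z.re → m ≤ φ σ) : m ≤ (cauchyTransform φ z).re := by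
  rcases le_total m 0 with hm0 | hm0
  · exact hm0.trans (re_cauchyTransform_nonneg hφ h0 hz)
  have hint : Integrable fun σ => φ σ * (z.re / (z.re ^ 2 + (z.im - σ) ^ 2)) := by
    refine (integrable_cauchyTransform hφ hz).re.congr (ae_of_all _ fun σ => ?_)
    simp [normSq_apply, pow_two]
  rw [re_cauchyTransform hφ hz]
  set s := Set.Icc (z.im - z.re) (z.im + z.re)
  calc m = ∫ _ in s, m / (2 * z.re) := by
        rw [setIntegral_const, measureReal_def, Real.volume_Icc,
          ENNReal.toReal_ofReal (by linarith),
          smul_eq_mul]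
        field_simp
        ring
    _ ≤ ∫ σ in s, φ σ * (z.re / (z.re ^ 2 + (z.im - σ) ^ 2)) := by
        refine setIntegral_mono_on (integrableOn_const (by simp [s])) hint.integrableOn
          measurableSet_Icc fun σ hσ => ?_
        have hσ' : |σ - z.im| ≤ z.re := abs_le.2 ⟨by linarith [hσ.1], by linarith [hσ.2]⟩
        have h2 : (z.im - σ) ^ 2 ≤ z.re ^ 2 := by
          rw [← sq_abs (z.im - σ), abs_sub_comm]; gcongr
        calc m / (2 * z.re) = m * (z.re / (z.re ^ 2 + z.re ^ 2)) := by field_simp; ring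
          _ ≤ _ := by
            have := hm σ hσ'
            have := h0 σ
            gcongr
    _ ≤ _ := setIntegral_le_integral hint
        (ae_of_all _ fun σ => mul_nonneg (h0 σ) (by positivity))

end CauchyTransform

/-! ### Admissible functions as a vector space: evaluation, boundary values, rescaling. -/

namespace InterpolationCouple

variable {X₀ X₁ V : Type*}
  [NormedAddCommGroup X₀] [NormedSpace ℂ X₀] [NormedAddCommGroup X₁] [NormedSpace ℂ X₁]
  [AddCommGroup V] [Module ℂ V] [TopologicalSpace V]
  [IsTopologicalAddGroup V] [T2Space V]

/-- The space of admissible functions together with their boundary values. -/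
def Adm (c : InterpolationCouple X₀ X₁ V) :
    Submodule ℂ ((ℂ → c.SumSpace) × (ℝ →ᵇ X₀) × (ℝ →ᵇ X₁)) where
  carrier := {T | c.IsAdmissible T.1 T.2.1 T.2.2}
  zero_mem' := IsAdmissible.zero c
  add_mem' := IsAdmissible.add
  smul_mem' r _ h := IsAdmissible.smul r h

namespace Adm

variable {c : InterpolationCouple X₀ X₁ V}

/-- The value of an admissible function at `θ`, as an element of the interpolation space. -/
def eval (c : InterpolationCouple X₀ X₁ V) (θ : Set.Ioo (0 : ℝ) 1) :
    c.Adm →ₗ[ℂ] c.InterpSpace θ where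
  toFun T := ⟨T.1.1 ((θ : ℝ) : ℂ), T.1.1, T.1.2.1, T.1.2.2, T.2, rfl⟩
  map_add' _ _ := rfl
  map_smul' _ _ := rfl

/-- The boundary values on the left. -/
def left (c : InterpolationCouple X₀ X₁ V) (τ : ℝ) : c.Adm →ₗ[ℂ] X₀ where
  toFun T := T.1.2.1 τ
  map_add' _ _ := rfl
  map_smul' _ _ := rfl

/-- The boundary values on the right. -/
def right (c : InterpolationCouple X₀ X₁ V) (τ : ℝ) : c.Adm →ₗ[ℂ] X₁ where
  toFun T := T.1.2.2 τ
  map_add' _ _ := rfl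
  map_smul' _ _ := rfl

theorem continuous_left (T : c.Adm) : Continuous fun τ => left c τ T := T.1.2.1.continuous

theorem continuous_right (T : c.Adm) : Continuous fun τ => right c τ T := T.1.2.2.continuous

theorem norm_left_le (T : c.Adm) (τ : ℝ) : ‖left c τ T‖ ≤ ‖T.1.2.1‖ := T.1.2.1.norm_coe_le_norm τ

theorem norm_right_le (T : c.Adm) (τ : ℝ) : ‖right c τ T‖ ≤ ‖T.1.2.2‖ :=
  T.1.2.2.norm_coe_le_norm τ

theorem norm_eval_le {θ : Set.Ioo (0 : ℝ) 1} (T : c.Adm) {M : ℝ} (hM : 0 ≤ M)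
    (h0 : ∀ τ, ‖left c τ T‖ ≤ M) (h1 : ∀ τ, ‖right c τ T‖ ≤ M) : ‖eval c θ T‖ ≤ M :=
  (InterpSpace.norm_le_of_mem ⟨T.1.1, T.1.2.1, T.1.2.2, T.2, rfl, rfl⟩).trans
    (max_le ((BoundedContinuousFunction.norm_le hM).2 h0)
      ((BoundedContinuousFunction.norm_le hM).2 h1))

/-- The infimum defining the norm need not be attained; the factor `2` leaves room when `x ≠ 0`, and
`x = 0` is lifted by the zero function. -/
theorem exists_eval_eq {θ : Set.Ioo (0 : ℝ) 1} (x : c.InterpSpace θ) :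
    ∃ T : c.Adm, eval c θ T = x ∧ (∀ τ, ‖left c τ T‖ ≤ 2 * ‖x‖) ∧
      ∀ τ, ‖right c τ T‖ ≤ 2 * ‖x‖ := by
  rcases eq_or_ne x 0 with rfl | hx
  · exact ⟨0, by simp, by simp, by simp⟩
  have hpos : 0 < ‖x‖ := norm_pos_iff.2 hx
  obtain ⟨_, ⟨f, g₀, g₁, h, hfx, rfl⟩, hlt⟩ :=
    Real.lt_sInf_add_pos (InterpSpace.normSet_nonempty x) hpos
  rw [← InterpSpace.norm_def] at hlt
  refine ⟨⟨(f, g₀, g₁), h⟩, Subtype.ext hfx, fun τ => ?_, fun τ => ?_⟩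
  · exact (g₀.norm_coe_le_norm τ).trans ((le_max_left _ _).trans (by linarith))
  · exact (g₁.norm_coe_le_norm τ).trans ((le_max_right _ _).trans (by linarith))

/-- Multiplication of admissible functions by bounded scalar functions. -/
theorem exists_smul (T : c.Adm) {φ : ℂ → ℂ} (hc : ContinuousOn φ (re ⁻¹' Set.Icc 0 1))
    (hd : DifferentiableOn ℂ φ (re ⁻¹' Set.Ioo 0 1)) {K : ℝ}
    (hK : ∀ z : ℂ, 0 ≤ z.re → z.re ≤ 1 → ‖φ z‖ ≤ K) :
    ∃ T' : c.Adm, (∀ θ : Set.Ioo (0 : ℝ) 1, eval c θ T' = φ (θ : ℝ) • eval c θ T) ∧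
      (∀ τ : ℝ, left c τ T' = φ (τ * I) • left c τ T) ∧
      ∀ τ : ℝ, right c τ T' = φ (1 + τ * I) • right c τ T := by
  have hK0 : 0 ≤ K := (norm_nonneg _).trans (hK 0 (by simp) (by simp))
  have c0 : Continuous fun τ : ℝ => φ (τ * I) :=
    hc.comp_continuous (by fun_prop) fun τ => by simp
  have c1 : Continuous fun τ : ℝ => φ (1 + τ * I) :=
    hc.comp_continuous (by fun_prop) fun τ => by simp
  let g₀ : ℝ →ᵇ X₀ := BoundedContinuousFunction.ofNormedAddCommGroup
    (fun τ : ℝ => φ (τ * I) • T.1.2.1 τ) (c0.smul T.1.2.1.continuous) (K * ‖T.1.2.1‖) fun τ => by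
      rw [norm_smul]
      exact mul_le_mul (hK _ (by simp) (by simp)) (norm_left_le T τ) (norm_nonneg _) hK0
  let g₁ : ℝ →ᵇ X₁ := BoundedContinuousFunction.ofNormedAddCommGroup
    (fun τ : ℝ => φ (1 + τ * I) • T.1.2.2 τ) (c1.smul T.1.2.2.continuous) (K * ‖T.1.2.2‖)
    fun τ => by
      rw [norm_smul]
      exact mul_le_mul (hK _ (by simp) (by simp)) (norm_right_le T τ) (norm_nonneg _) hK0
  have hadm : c.IsAdmissible (fun z => φ z • T.1.1 z) g₀ g₁ :=
    { continuousOn := hc.smul T.2.continuousOn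
      differentiableOn := hd.smul T.2.differentiableOn
      bounded := by
        obtain ⟨C, hC⟩ := T.2.bounded
        refine ⟨K * C, fun z h0 h1 => ?_⟩
        rw [norm_smul]
        exact mul_le_mul (hK z h0 h1) (hC z h0 h1) (norm_nonneg _) hK0
      left := fun t => by
        rw [T.2.left]
        exact (map_smul c.incl₀ _ _).symm
      right := fun t => by
        rw [T.2.right]
        exact (map_smul c.incl₁ _ _).symm }
  exact ⟨⟨(_, g₀, g₁), hadm⟩, fun θ => rfl, fun τ => rfl, fun τ => rfl⟩

/-- Rescaling of an admissible function, leaving its value at `θ` fixed. -/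
theorem exists_rescale (θ : Set.Ioo (0 : ℝ) 1) {r : ℝ} (hr : 0 < r) (T : c.Adm) :
    ∃ T' : c.Adm, eval c θ T' = eval c θ T ∧
      (∀ τ, ‖left c τ T'‖ = r ^ (-(θ : ℝ)) * ‖left c τ T‖) ∧
      ∀ τ, ‖right c τ T'‖ = r ^ (1 - (θ : ℝ)) * ‖right c τ T‖ := by
  have hr' : (r : ℂ) ≠ 0 := ofReal_ne_zero.2 hr.ne'
  have hn : ∀ z : ℂ, ‖(r : ℂ) ^ (z - (θ : ℝ))‖ = r ^ (z.re - θ) := fun z => by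
    rw [norm_cpow_eq_rpow_re_of_pos hr]; simp
  have hdiff : Differentiable ℂ fun z : ℂ => (r : ℂ) ^ (z - (θ : ℝ)) := by
    intro z
    exact DifferentiableAt.const_cpow (by fun_prop) (Or.inl hr')
  -- The multiplier equals `1` at `θ` and has constant modulus on each boundary line.
  obtain ⟨T', h1, h2, h3⟩ := exists_smul T (φ := fun z : ℂ => (r : ℂ) ^ (z - (θ : ℝ)))
    (K := r ^ (-(θ : ℝ)) * max 1 r) hdiff.continuous.continuousOn hdiff.differentiableOn
    (fun z h0 h1 => by
      rw [hn, sub_eq_neg_add, Real.rpow_add hr]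
      gcongr
      rcases le_total 1 r with h | h
      · exact (Real.rpow_le_rpow_of_exponent_le h h1).trans (by simp)
      · exact (Real.rpow_le_one hr.le h h0).trans (by simp))
  refine ⟨T', by simp [h1], fun τ => ?_, fun τ => ?_⟩
  · rw [h2, norm_smul, hn]; simp
  · rw [h3, norm_smul, hn]; simp

end Adm

end InterpolationCouple

/-! ### Bounding the interpolation norm by Gaussian means of boundary values. -/

namespace InterpolationCouple.Adm

open ProbabilityTheory

variable {X₀ X₁ V : Type*}
  [NormedAddCommGroup X₀] [NormedSpace ℂ X₀] [NormedAddCommGroup X₁] [NormedSpace ℂ X₁]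
  [AddCommGroup V] [Module ℂ V] [TopologicalSpace V]
  [IsTopologicalAddGroup V] [T2Space V] {c : InterpolationCouple X₀ X₁ V}

theorem gaussianPDFReal_zero_one (τ : ℝ) :
    gaussianPDFReal 0 1 τ = (√(2 * Real.pi))⁻¹ * Real.exp (-τ ^ 2 / 2) := by
  simp [gaussianPDFReal]

theorem tendsto_gaussianPDFReal :
    Filter.Tendsto (gaussianPDFReal 0 1) (Filter.cocompact ℝ) (nhds 0) := by
  have h1 : Filter.Tendsto (fun τ : ℝ => ‖τ‖ ^ 2 / 2) (Filter.cocompact ℝ) Filter.atTop :=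
    Filter.Tendsto.atTop_div_const two_pos
      ((Filter.tendsto_pow_atTop two_ne_zero).comp (tendsto_norm_cocompact_atTop (E := ℝ)))
  have h2 := (Real.tendsto_exp_neg_atTop_nhds_zero.comp h1).const_mul (√(2 * Real.pi))⁻¹
  rw [mul_zero] at h2
  refine h2.congr fun τ => ?_
  rw [gaussianPDFReal_zero_one, Function.comp_apply, Real.norm_eq_abs, sq_abs, neg_div]

/-- Bounded continuous functions become uniformly continuous after multiplication with a
Gaussian. -/
theorem uniformContinuous_gaussian_mul {u : ℝ → ℝ} (hu : Continuous u) {B : ℝ}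
    (hB : ∀ τ, |u τ| ≤ B) (K : ℝ) :
    UniformContinuous fun τ => K * (gaussianPDFReal 0 1 τ * u τ) := by
  have hc : Continuous (gaussianPDFReal 0 1) := by
    simp only [funext gaussianPDFReal_zero_one]
    fun_prop
  refine Continuous.uniformContinuous_of_tendsto_cocompact (x := 0)
    (continuous_const.mul (hc.mul hu)) ?_
  have : Filter.Tendsto (fun τ => gaussianPDFReal 0 1 τ * u τ) (Filter.cocompact ℝ) (nhds 0) := by
    refine squeeze_zero_norm (a := fun τ => gaussianPDFReal 0 1 τ * B) (fun τ => ?_) ?_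
    · rw [norm_mul, Real.norm_of_nonneg (gaussianPDFReal_nonneg _ _ _), Real.norm_eq_abs]
      exact mul_le_mul_of_nonneg_left (hB τ) (gaussianPDFReal_nonneg _ _ _)
    · simpa using tendsto_gaussianPDFReal.mul_const B
  simpa using this.const_mul K

theorem integrable_gaussian_mul {u : ℝ → ℝ} (hu : Continuous u) {B : ℝ}
    (hB : ∀ τ, |u τ| ≤ B) : Integrable fun τ => gaussianPDFReal 0 1 τ * u τ :=
  (integrable_gaussianPDFReal 0 1).mul_bdd (c := B) hu.aestronglyMeasurable (ae_of_all _ hB)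

/-- The interpolation norm is bounded by Gaussian means of the norms of the boundary values. -/
theorem norm_eval_le_integral_add (θ : Set.Ioo (0 : ℝ) 1) (T : c.Adm) :
    ‖eval c θ T‖ ≤ √(2 * Real.pi) * Real.exp (1 / 2) *
      ((∫ τ, gaussianPDFReal 0 1 τ * ‖left c τ T‖) * (θ : ℝ)⁻¹ +
        (∫ τ, gaussianPDFReal 0 1 τ * ‖right c τ T‖) * (1 - (θ : ℝ))⁻¹) := by
  have hθ := θ.2.1
  have hθ' : 0 < 1 - (θ : ℝ) := sub_pos.2 θ.2.2
  -- Chosen so that `K` times the Gaussian density is `exp (1/2 - τ²/2)`, the bound for `exp ((z² -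
  -- θ²)/2)` on the strip. The Gaussian also makes the merely bounded boundary norms integrable and
  -- uniformly continuous.
  set K := √(2 * Real.pi) * Real.exp (1 / 2) with hK
  have hK0 : 0 ≤ K := by positivity
  set φ₀ : ℝ → ℝ := fun τ => K * (gaussianPDFReal 0 1 τ * ‖left c τ T‖) with hφ₀
  set φ₁ : ℝ → ℝ := fun τ => K * (gaussianPDFReal 0 1 τ * ‖right c τ T‖) with hφ₁
  have c0 : Continuous fun τ => ‖left c τ T‖ := (continuous_left T).norm
  have c1 : Continuous fun τ => ‖right c τ T‖ := (continuous_right T).norm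
  have b0 : ∀ τ, |‖left c τ T‖| ≤ ‖T.1.2.1‖ := fun τ => by
    rw [abs_norm]; exact norm_left_le T τ
  have b1 : ∀ τ, |‖right c τ T‖| ≤ ‖T.1.2.2‖ := fun τ => by
    rw [abs_norm]; exact norm_right_le T τ
  have i0 : Integrable φ₀ := (integrable_gaussian_mul c0 b0).const_mul K
  have i1 : Integrable φ₁ := (integrable_gaussian_mul c1 b1).const_mul K
  have i1' : Integrable fun τ => φ₁ (-τ) := i1.comp_neg
  have n0 : ∀ τ, 0 ≤ φ₀ τ := fun τ =>
    mul_nonneg hK0 (mul_nonneg (gaussianPDFReal_nonneg _ _ _) (norm_nonneg _))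
  have n1 : ∀ τ, 0 ≤ φ₁ τ := fun τ =>
    mul_nonneg hK0 (mul_nonneg (gaussianPDFReal_nonneg _ _ _) (norm_nonneg _))
  have eK : ∀ τ : ℝ, K * gaussianPDFReal 0 1 τ = Real.exp (1 / 2 - τ ^ 2 / 2) := fun τ => by
    have : √(2 * Real.pi) ≠ 0 := by positivity
    rw [gaussianPDFReal_zero_one, hK, sub_eq_add_neg, Real.exp_add, ← neg_div]
    field_simp
  have key : ∀ η > 0, ‖eval c θ T‖ ≤
      η + (∫ τ, φ₀ τ) * (θ : ℝ)⁻¹ + (∫ τ, φ₁ τ) * (1 - (θ : ℝ))⁻¹ := by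
    intro η hη
    obtain ⟨δ₀, hδ₀, hu₀⟩ := Metric.uniformContinuous_iff.1
      (uniformContinuous_gaussian_mul c0 b0 K) η hη
    obtain ⟨δ₁, hδ₁, hu₁⟩ := Metric.uniformContinuous_iff.1
      (uniformContinuous_gaussian_mul c1 b1 K) η hη
    set ε := min δ₀ δ₁ / 2
    have hε : 0 < ε := by positivity
    have hε₀ : ε < δ₀ := (half_lt_self (by positivity)).trans_le (min_le_left _ _)
    have hε₁ : ε < δ₁ := (half_lt_self (by positivity)).trans_le (min_le_right _ _)
    -- An analytic function whose modulus dominates `φ₀` on the left line and `φ₁` on the right. The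
    -- shift by `ε` keeps the transforms analytic up to the boundary; by uniform continuity it loses
    -- at most `η`, which the constant term restores. The density `φ₁` is reflected because `1 - (1
    -- + iτ) = -iτ`.
    set w : ℂ → ℂ := fun z => η + cauchyTransform φ₀ (z + ε) +
      cauchyTransform (fun τ => φ₁ (-τ)) (1 - z + ε) with hw
    have p0 : ∀ z : ℂ, 0 ≤ z.re → 0 < (z + ε).re := fun z hz => by
      simp only [add_re, ofReal_re]; linarith
    have p1 : ∀ z : ℂ, z.re ≤ 1 → 0 < (1 - z + ε).re := fun z hz => by
      simp only [add_re, sub_re, one_re, ofReal_re]; linarith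
    have hre : ∀ z : ℂ, 0 ≤ z.re → z.re ≤ 1 → η ≤ (w z).re := fun z h0 h1 => by
      have a0 := re_cauchyTransform_nonneg i0 n0 (p0 z h0)
      have a1 := re_cauchyTransform_nonneg i1' (fun τ => n1 (-τ)) (p1 z h1)
      simp only [hw, add_re, ofReal_re] at a0 a1 ⊢
      linarith
    have hw0 : ∀ z : ℂ, 0 ≤ z.re → z.re ≤ 1 → w z ≠ 0 := fun z h0 h1 e => by
      have := hre z h0 h1
      rw [e, zero_re] at this
      linarith
    have hwn : ∀ z : ℂ, 0 ≤ z.re → z.re ≤ 1 → η ≤ ‖w z‖ := fun z h0 h1 =>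
      (hre z h0 h1).trans ((le_abs_self _).trans (abs_re_le_norm _))
    have hd : ∀ z : ℂ, 0 ≤ z.re → z.re ≤ 1 → DifferentiableAt ℂ w z := fun z h0 h1 => by
      refine ((differentiableAt_const _).add ?_).add ?_
      · exact (differentiableAt_cauchyTransform i0 (p0 z h0)).comp z
          (f := fun z : ℂ => z + ε) (by fun_prop)
      · exact (differentiableAt_cauchyTransform i1' (p1 z h1)).comp z
          (f := fun z : ℂ => 1 - z + ε) (by fun_prop)
    -- The function `ψ T` has boundary values of norm at most `1`, while `ψ(θ) = 1 / w(θ)`; hence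
    -- `‖T(θ)‖ ≤ |w(θ)|`.
    set ψ : ℂ → ℂ := fun z => cexp ((z ^ 2 - (θ : ℝ) ^ 2) / 2) * (w z)⁻¹ with hψ
    have hψd : ∀ z : ℂ, 0 ≤ z.re → z.re ≤ 1 → DifferentiableAt ℂ ψ z := fun z h0 h1 =>
      DifferentiableAt.mul (by fun_prop) ((hd z h0 h1).inv (hw0 z h0 h1))
    have hexp : ∀ z : ℂ, 0 ≤ z.re → z.re ≤ 1 →
        ‖cexp ((z ^ 2 - (θ : ℝ) ^ 2) / 2)‖ ≤ Real.exp (1 / 2 - z.im ^ 2 / 2) := by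
      intro z h0 h1
      rw [norm_exp]
      gcongr
      have e : ((z ^ 2 - ((θ : ℝ) : ℂ) ^ 2) / 2).re = (z.re ^ 2 - z.im ^ 2 - (θ : ℝ) ^ 2) / 2 := by
        rw [div_ofNat_re]
        simp [pow_two]
      rw [e]
      nlinarith [sq_nonneg (θ : ℝ)]
    obtain ⟨T', h1, h2, h3⟩ := exists_smul T (φ := ψ) (K := Real.exp (1 / 2) * η⁻¹)
      (fun z hz => (hψd z hz.1 hz.2).continuousAt.continuousWithinAt)
      (fun z hz => (hψd z hz.1.le hz.2.le).differentiableWithinAt)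
      (fun z h0 h1 => by
        rw [norm_mul, norm_inv]
        gcongr
        · exact (hexp z h0 h1).trans (Real.exp_le_exp.2 (by nlinarith [sq_nonneg z.im]))
        · exact hwn z h0 h1)
    have hle : ‖eval c θ T'‖ ≤ 1 := by
      refine norm_eval_le T' zero_le_one (fun τ => ?_) fun τ => ?_
      · have hz0 : 0 ≤ ((τ : ℂ) * I).re := by simp
        have hz1 : ((τ : ℂ) * I).re ≤ 1 := by simp
        have hm : φ₀ τ - η ≤ (cauchyTransform φ₀ ((τ : ℂ) * I + ε)).re := by
          refine le_re_cauchyTransform i0 n0 (p0 _ hz0) fun σ hσ => ?_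
          have hσ' : |σ - τ| ≤ ε := by simpa using hσ
          have := hu₀ (a := σ) (b := τ) (by rw [Real.dist_eq]; exact hσ'.trans_lt hε₀)
          rw [Real.dist_eq] at this
          have := (abs_lt.1 this).1
          simp only [hφ₀] at *
          linarith
        have hm' := re_cauchyTransform_nonneg i1' (fun τ => n1 (-τ)) (p1 _ hz1)
        have hφw : φ₀ τ ≤ ‖w (τ * I)‖ := by
          refine le_trans ?_ ((le_abs_self _).trans (abs_re_le_norm _))
          simp only [hw, add_re, ofReal_re] at hm hm' ⊢
          linarith
        rw [h2, norm_smul, hψ, norm_mul, norm_inv]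
        have hwpos : 0 < ‖w (τ * I)‖ := norm_pos_iff.2 (hw0 _ hz0 hz1)
        rw [mul_right_comm, ← div_eq_mul_inv, div_le_one hwpos]
        refine le_trans ?_ hφw
        simp only [hφ₀]
        rw [← mul_assoc, eK]
        gcongr
        simpa using hexp _ hz0 hz1
      · have hz0 : 0 ≤ (1 + (τ : ℂ) * I).re := by simp
        have hz1 : (1 + (τ : ℂ) * I).re ≤ 1 := by simp
        have hm : φ₁ τ - η ≤
            (cauchyTransform (fun τ => φ₁ (-τ)) (1 - (1 + (τ : ℂ) * I) + ε)).re := by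
          refine le_re_cauchyTransform i1' (fun τ => n1 (-τ)) (p1 _ hz1) fun σ hσ => ?_
          have hσ' : |σ + τ| ≤ ε := by simpa using hσ
          have := hu₁ (a := -σ) (b := τ) (by
            rw [Real.dist_eq, ← abs_neg]
            exact (by rw [neg_sub, sub_neg_eq_add, add_comm]; exact hσ'.trans_lt hε₁))
          rw [Real.dist_eq] at this
          have := (abs_lt.1 this).1
          simp only [hφ₁] at *
          linarith
        have hm' := re_cauchyTransform_nonneg i0 n0 (p0 _ hz0)
        have hφw : φ₁ τ ≤ ‖w (1 + τ * I)‖ := by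
          refine le_trans ?_ ((le_abs_self _).trans (abs_re_le_norm _))
          simp only [hw, add_re, ofReal_re] at hm hm' ⊢
          linarith
        rw [h3, norm_smul, hψ, norm_mul, norm_inv]
        have hwpos : 0 < ‖w (1 + τ * I)‖ := norm_pos_iff.2 (hw0 _ hz0 hz1)
        rw [mul_right_comm, ← div_eq_mul_inv, div_le_one hwpos]
        refine le_trans ?_ hφw
        simp only [hφ₁]
        rw [← mul_assoc, eK]
        gcongr
        simpa using hexp _ hz0 hz1
    have hθ0 : 0 ≤ ((θ : ℝ) : ℂ).re := by simpa using hθ.le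
    have hθ1 : ((θ : ℝ) : ℂ).re ≤ 1 := by simpa using θ.2.2.le
    have hwθ := hw0 _ hθ0 hθ1
    have hev : eval c θ T = w (θ : ℝ) • eval c θ T' := by
      rw [h1, hψ, smul_smul]
      simp [hwθ]
    rw [hev, norm_smul]
    refine (mul_le_of_le_one_right (norm_nonneg _) hle).trans ?_
    refine (norm_add₃_le).trans (add_le_add (add_le_add ?_ ?_) ?_)
    · simp [abs_of_pos hη]
    · refine (norm_cauchyTransform_le i0 n0 (p0 _ hθ0)).trans ?_
      refine mul_le_mul_of_nonneg_left ?_ (integral_nonneg n0)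
      gcongr
      simp [hε.le]
    · refine (norm_cauchyTransform_le i1' (fun τ => n1 (-τ)) (p1 _ hθ1)).trans ?_
      rw [integral_neg_eq_self φ₁]
      refine mul_le_mul_of_nonneg_left ?_ (integral_nonneg n1)
      gcongr
      simp [hε.le]
  refine le_of_forall_pos_le_add fun η hη => (key η hη).trans_eq ?_
  rw [hφ₀, hφ₁, integral_const_mul, integral_const_mul]
  ring

/-- The interpolation norm is bounded by the geometric mean of Gaussian means of the norms of the
boundary values. -/
theorem exists_enorm_eval_le (c : InterpolationCouple X₀ X₁ V) (θ : Set.Ioo (0 : ℝ) 1) :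
    ∃ C : ℝ≥0, ∀ T : c.Adm, ‖eval c θ T‖ₑ ≤
      C * ((∫⁻ τ, ‖left c τ T‖ₑ ∂(gaussianReal 0 1)) ^ (1 - (θ : ℝ)) *
        (∫⁻ τ, ‖right c τ T‖ₑ ∂(gaussianReal 0 1)) ^ (θ : ℝ)) := by
  have hθ := θ.2.1
  have hθ' : 0 < 1 - (θ : ℝ) := sub_pos.2 θ.2.2
  set C := √(2 * Real.pi) * Real.exp (1 / 2) * ((θ : ℝ)⁻¹ + (1 - (θ : ℝ))⁻¹) with hC
  have hC0 : 0 ≤ C := by positivity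
  refine ⟨⟨C, hC0⟩, fun T => ?_⟩
  set A := ∫ τ, gaussianPDFReal 0 1 τ * ‖left c τ T‖ with hA
  set B := ∫ τ, gaussianPDFReal 0 1 τ * ‖right c τ T‖ with hB
  have hA0 : 0 ≤ A := integral_nonneg fun τ =>
    mul_nonneg (gaussianPDFReal_nonneg _ _ _) (norm_nonneg _)
  have hB0 : 0 ≤ B := integral_nonneg fun τ =>
    mul_nonneg (gaussianPDFReal_nonneg _ _ _) (norm_nonneg _)
  have hAl : ∫⁻ τ, ‖left c τ T‖ₑ ∂(gaussianReal 0 1) = ENNReal.ofReal A := by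
    have := integral_gaussianReal_eq_integral_smul (μ := 0) (f := fun τ => ‖left c τ T‖) one_ne_zero
    simp only [smul_eq_mul] at this
    rw [hA, ← this, ofReal_integral_norm_eq_lintegral_enorm]
    exact Integrable.of_bound (continuous_left T).aestronglyMeasurable ‖T.1.2.1‖
      (ae_of_all _ (norm_left_le T))
  have hBl : ∫⁻ τ, ‖right c τ T‖ₑ ∂(gaussianReal 0 1) = ENNReal.ofReal B := by
    have := integral_gaussianReal_eq_integral_smul (μ := 0) (f := fun τ => ‖right c τ T‖)
      one_ne_zero
    simp only [smul_eq_mul] at this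
    rw [hB, ← this, ofReal_integral_norm_eq_lintegral_enorm]
    exact Integrable.of_bound (continuous_right T).aestronglyMeasurable ‖T.1.2.2‖
      (ae_of_all _ (norm_right_le T))
  -- Rescaling by `(A + δ)/(B + δ)` balances the two terms of the additive bound, making each at
  -- most the geometric mean; `δ` covers vanishing means and is sent to `0`.
  have step : ∀ δ > 0, ‖eval c θ T‖ ≤ C * ((A + δ) ^ (1 - (θ : ℝ)) * (B + δ) ^ (θ : ℝ)) := by
    intro δ hδ
    have hAδ : 0 < A + δ := by positivity
    have hBδ : 0 < B + δ := by positivity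
    obtain ⟨T', h1, h2, h3⟩ := exists_rescale θ (r := (A + δ) / (B + δ)) (by positivity) T
    have hb := norm_eval_le_integral_add θ T'
    simp only [h1, h2, h3, mul_left_comm (gaussianPDFReal 0 1 _), integral_const_mul,
      ← hA, ← hB] at hb
    set M := (A + δ) ^ (1 - (θ : ℝ)) * (B + δ) ^ (θ : ℝ) with hM
    have e0 : ((A + δ) / (B + δ)) ^ (-(θ : ℝ)) * (A + δ) = M := by
      rw [Real.div_rpow hAδ.le hBδ.le, Real.rpow_neg hBδ.le, div_inv_eq_mul, mul_right_comm,
        ← Real.rpow_add_one hAδ.ne', hM]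
      ring_nf
    have e1 : ((A + δ) / (B + δ)) ^ (1 - (θ : ℝ)) * (B + δ) = M := by
      have e2 : (B + δ) ^ (1 - (θ : ℝ)) * (B + δ) ^ (θ : ℝ) = B + δ := by
        rw [← Real.rpow_add hBδ, sub_add_cancel, Real.rpow_one]
      have e3 : 0 < (B + δ) ^ (1 - (θ : ℝ)) := Real.rpow_pos_of_pos hBδ _
      rw [Real.div_rpow hAδ.le hBδ.le, hM]
      nth_rewrite 2 [← e2]
      field_simp
    have l0 : ((A + δ) / (B + δ)) ^ (-(θ : ℝ)) * A ≤ M := by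
      rw [← e0]
      gcongr
      linarith
    have l1 : ((A + δ) / (B + δ)) ^ (1 - (θ : ℝ)) * B ≤ M := by
      rw [← e1]
      gcongr
      linarith
    calc ‖eval c θ T‖ ≤ _ := hb
      _ ≤ √(2 * Real.pi) * Real.exp (1 / 2) * (M * (θ : ℝ)⁻¹ + M * (1 - (θ : ℝ))⁻¹) := by
          gcongr
      _ = C * M := by rw [hC]; ring
  have lim : ‖eval c θ T‖ ≤ C * (A ^ (1 - (θ : ℝ)) * B ^ (θ : ℝ)) := by
    have ht : Filter.Tendsto (fun δ : ℝ => C * ((A + δ) ^ (1 - (θ : ℝ)) * (B + δ) ^ (θ : ℝ)))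
        (nhdsWithin 0 (Set.Ioi 0)) (nhds (C * ((A + 0) ^ (1 - (θ : ℝ)) * (B + 0) ^ (θ : ℝ)))) := by
      have hcont : Continuous fun δ : ℝ => C * ((A + δ) ^ (1 - (θ : ℝ)) * (B + δ) ^ (θ : ℝ)) :=
        continuous_const.mul
          (((continuous_const.add continuous_id).rpow_const fun _ => Or.inr hθ'.le).mul
            ((continuous_const.add continuous_id).rpow_const fun _ => Or.inr hθ.le))
      exact (hcont.tendsto 0).mono_left nhdsWithin_le_nhds
    rw [add_zero, add_zero] at ht
    exact ge_of_tendsto ht (eventually_nhdsWithin_of_forall fun δ hδ => step δ hδ)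
  rw [hAl, hBl, ENNReal.ofReal_rpow_of_nonneg hA0 hθ'.le, ENNReal.ofReal_rpow_of_nonneg hB0 hθ.le,
    ← ENNReal.ofReal_mul (by positivity), ← ofReal_norm]
  refine (ENNReal.ofReal_le_ofReal lim).trans_eq ?_
  rw [ENNReal.ofReal_mul hC0, ENNReal.ofReal_eq_coe_nnreal hC0]
  rfl

end InterpolationCouple.Adm

/-! ### Trigonometric polynomials depending on a parameter -/

section Coefficients

variable {M N X : Type*} [AddCommGroup M] [Module ℂ M] [AddCommGroup N] [Module ℂ N]
  [NormedAddCommGroup X] [NormedSpace ℂ X]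

/-- Application of a linear map to the coefficients of a trigonometric polynomial. -/
def mapCoeff (L : M →ₗ[ℂ] N) : (ℤ →₀ M) →ₗ[ℂ] (ℤ →₀ N) :=
  Finsupp.mapRange.linearMap L

theorem mapCoeff_apply (L : M →ₗ[ℂ] N) (F : ℤ →₀ M) (n : ℤ) : mapCoeff L F n = L (F n) := rfl

theorem mapCoeff_single (L : M →ₗ[ℂ] N) (n : ℤ) (m : M) :
    mapCoeff L (Finsupp.single n m) = Finsupp.single n (L m) := by
  simp [mapCoeff]

theorem mapCoeff_filter (L : M →ₗ[ℂ] N) (p : ℤ → Prop) [DecidablePred p] (F : ℤ →₀ M) :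
    mapCoeff L (F.filter p) = (mapCoeff L F).filter p := by
  ext n
  by_cases h : p n <;> simp [mapCoeff_apply, h]

theorem trigPoly_mapCoeff (L : M →ₗ[ℂ] X) (F : ℤ →₀ M) (t : UnitAddCircle) :
    trigPoly (mapCoeff L F) t = L (F.sum fun n m => (fourier n t : ℂ) • m) := by
  rw [trigPoly, mapCoeff, Finsupp.mapRange.linearMap_apply, Finsupp.sum_mapRange_index (by simp),
    map_finsuppSum]
  simp

theorem trigPoly_mapCoeff_eq_sum (L : M →ₗ[ℂ] X) (F : ℤ →₀ M) (t : UnitAddCircle) :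
    trigPoly (mapCoeff L F) t = ∑ n ∈ F.support, (fourier n t : ℂ) • L (F n) := by
  rw [trigPoly_mapCoeff, Finsupp.sum, map_sum]
  simp

theorem trigPoly_eq_sum (a : ℤ →₀ X) (t : UnitAddCircle) :
    trigPoly a t = ∑ n ∈ a.support, (fourier n t : ℂ) • a n := rfl

theorem continuous_trigPoly (a : ℤ →₀ X) : Continuous (trigPoly a) := by
  have : trigPoly a = fun t => ∑ n ∈ a.support, (fourier n t : ℂ) • a n := rfl
  rw [this]
  fun_prop

theorem trigPoly_zero : trigPoly (0 : ℤ →₀ X) = 0 := by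
  ext t; simp [trigPoly]

theorem trigPoly_add (a b : ℤ →₀ X) : trigPoly (a + b) = trigPoly a + trigPoly b := by
  ext t
  exact Finsupp.sum_add_index (by simp) (by simp)

theorem trigPoly_sum {ι : Type*} (s : Finset ι) (a : ι → ℤ →₀ X) :
    trigPoly (∑ i ∈ s, a i) = ∑ i ∈ s, trigPoly (a i) :=
  map_sum (AddMonoidHom.mk' (trigPoly (X := X)) trigPoly_add) a s

theorem trigPoly_single (n : ℤ) (x : X) (t : UnitAddCircle) :
    trigPoly (Finsupp.single n x) t = (fourier n t : ℂ) • x := by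
  simp [trigPoly]

omit [NormedSpace ℂ X] in
theorem torusLpNorm_zero (p : ℝ≥0∞) : torusLpNorm p (0 : UnitAddCircle → X) = 0 := eLpNorm_zero

theorem torusLpNorm_ne_top (p : ℝ≥0∞) (a : ℤ →₀ X) : torusLpNorm p (trigPoly a) ≠ ∞ := by
  have := (BoundedContinuousFunction.mkOfCompact ⟨_, continuous_trigPoly a⟩).memLp_top
    (μ := AddCircle.haarAddCircle)
  exact (this.mono_exponent le_top).eLpNorm_ne_top

end Coefficients

section Family

open ProbabilityTheory

variable {M X : Type*} [AddCommGroup M] [Module ℂ M] [NormedAddCommGroup X] [NormedSpace ℂ X]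
  {L : ℝ → M →ₗ[ℂ] X}

theorem continuous_trigPoly_family (hc : ∀ m, Continuous fun τ => L τ m) (F : ℤ →₀ M) :
    Continuous fun z : UnitAddCircle × ℝ => trigPoly (mapCoeff (L z.2) F) z.1 := by
  simp only [trigPoly_mapCoeff_eq_sum]
  refine continuous_finsetSum _ fun n _ => ?_
  exact ((fourier n).continuous.comp continuous_fst).smul ((hc _).comp continuous_snd)

theorem exists_bound_trigPoly_family (hb : ∀ m, ∃ K : ℝ, ∀ τ, ‖L τ m‖ ≤ K) (F : ℤ →₀ M) :
    ∃ K : ℝ≥0, ∀ t τ, ‖trigPoly (mapCoeff (L τ) F) t‖ₑ ≤ K := by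
  choose K hK using hb
  have hK0 : 0 ≤ ∑ n ∈ F.support, K (F n) :=
    Finset.sum_nonneg fun n _ => (norm_nonneg _).trans (hK (F n) 0)
  refine ⟨⟨_, hK0⟩, fun t τ => ?_⟩
  have : ‖trigPoly (mapCoeff (L τ) F) t‖ ≤ ∑ n ∈ F.support, K (F n) := by
    rw [trigPoly_mapCoeff_eq_sum]
    refine norm_sum_le_of_le _ fun n _ => ?_
    rw [norm_smul, fourier_apply, Circle.norm_coe, one_mul]
    exact hK (F n) τ
  rw [← ofReal_norm]
  exact (ENNReal.ofReal_le_ofReal this).trans_eq (ENNReal.ofReal_eq_coe_nnreal hK0)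

theorem extNorm_const_le (p : ℝ≥0∞) (hp : 1 ≤ p) (K : ℝ≥0∞) :
    extNorm (AddCircle.haarAddCircle (T := 1)) p (fun _ => K) ≤ K := by
  unfold extNorm
  split_ifs with h
  · exact iSup_le fun _ => le_rfl
  · rw [lintegral_const, measure_univ, mul_one, ← ENNReal.rpow_mul,
      mul_one_div_cancel (toReal_pos_of_one_le hp h).ne', ENNReal.rpow_one]

/-- Minkowski's inequality; the finiteness it requires comes from a bound uniform in `t` and `τ`. -/
theorem extNorm_lintegral_trigPoly_le (hc : ∀ m, Continuous fun τ => L τ m)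
    (hb : ∀ m, ∃ K : ℝ, ∀ τ, ‖L τ m‖ ≤ K) {p : ℝ≥0∞} (h1 : 1 ≤ p) (h2 : p ≠ ∞) (F : ℤ →₀ M) :
    extNorm AddCircle.haarAddCircle p
        (fun t => ∫⁻ τ, ‖trigPoly (mapCoeff (L τ) F) t‖ₑ ∂(gaussianReal 0 1)) ≤
      ∫⁻ τ, torusLpNorm p (trigPoly (mapCoeff (L τ) F)) ∂(gaussianReal 0 1) := by
  simp only [torusLpNorm_eq_extNorm h1 h2]
  refine extNorm_lintegral_le _ _ h1 (continuous_trigPoly_family hc F).enorm.measurable fun _ => ?_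
  obtain ⟨K, hK⟩ := exists_bound_trigPoly_family hb F
  refine ne_top_of_le_ne_top ENNReal.coe_ne_top
    ((extNorm_mono _ _ fun t => ?_).trans (extNorm_const_le p h1 K))
  exact (lintegral_mono fun τ => hK t τ).trans_eq (by simp)

theorem measurable_torusLpNorm_family (hc : ∀ m, Continuous fun τ => L τ m) {p : ℝ≥0∞}
    (h1 : 1 ≤ p) (h2 : p ≠ ∞) (F : ℤ →₀ M) :
    Measurable fun τ => torusLpNorm p (trigPoly (mapCoeff (L τ) F)) := by
  simp only [torusLpNorm_eq_extNorm h1 h2, extNorm_of_ne_top _ h2]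
  exact ((continuous_trigPoly_family hc
    F).enorm.measurable.pow_const _).lintegral_prod_left'.pow_const _

theorem seqNorm_ne_top {ι : Type*} {q : ℝ≥0∞} (hq : 1 ≤ q) (hqt : q ≠ ∞) {x : ι → ℝ≥0∞}
    (hx : ∀ i, x i ≠ ∞) (hfin : {i | x i ≠ 0}.Finite) : seqNorm q x ≠ ∞ := by
  have hq0 := toReal_pos_of_one_le hq hqt
  rw [seqNorm, if_neg hqt, tsum_eq_sum (s := hfin.toFinset)]
  · refine ENNReal.rpow_ne_top_of_nonneg (by positivity) (ENNReal.sum_ne_top.2 fun i _ => ?_)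
    exact ENNReal.rpow_ne_top_of_nonneg hq0.le (hx i)
  · intro i hi
    have : x i = 0 := by simpa using hi
    rw [this, ENNReal.zero_rpow_of_pos hq0]

/-- Minkowski's inequality for the counting measure; having only finitely many non-zero `F i`
supplies the finiteness. -/
theorem seqNorm_lintegral_trigPoly_le {ι : Type*} [Countable ι]
    (hc : ∀ m, Continuous fun τ => L τ m) (hb : ∀ m, ∃ K : ℝ, ∀ τ, ‖L τ m‖ ≤ K) {p q : ℝ≥0∞}
    (h1 : 1 ≤ p) (h2 : p ≠ ∞) (hq : 1 ≤ q) {F : ι → ℤ →₀ M} (hF : {i | F i ≠ 0}.Finite) {B : ℝ≥0∞}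
    (hB : ∀ τ, seqNorm q (fun i => torusLpNorm p (trigPoly (mapCoeff (L τ) (F i)))) ≤ B) :
    seqNorm q (fun i => ∫⁻ τ, torusLpNorm p (trigPoly (mapCoeff (L τ) (F i))) ∂(gaussianReal 0 1)) ≤
      B := by
  let _ : MeasurableSpace ι := ⊤
  have hfin : q ≠ ∞ → seqNorm q (fun i => ∫⁻ τ, torusLpNorm p (trigPoly (mapCoeff (L τ) (F i)))
      ∂(gaussianReal 0 1)) ≠ ∞ := fun hqt => by
    refine seqNorm_ne_top hq hqt (fun i => ?_) (hF.subset fun i hi h => hi ?_)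
    · obtain ⟨K, hK⟩ := exists_bound_trigPoly_family hb (F i)
      refine ne_top_of_le_ne_top (ENNReal.coe_ne_top (r := K)) ?_
      calc _ ≤ ∫⁻ _, (K : ℝ≥0∞) ∂(gaussianReal 0 1) := by
            refine lintegral_mono fun τ => ?_
            rw [torusLpNorm_eq_extNorm h1 h2]
            exact (extNorm_mono _ _ fun t => hK t τ).trans (extNorm_const_le p h1 K)
        _ = K := by simp
    · simp [h, trigPoly_zero, torusLpNorm_zero]
  simp only [seqNorm_eq_extNorm] at hB hfin ⊢
  refine (extNorm_lintegral_le Measure.count (gaussianReal 0 1) hq ?_ hfin).trans ?_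
  · exact measurable_from_prod_countable_right
      fun i => measurable_torusLpNorm_family hc h1 h2 (F i)
  · exact (lintegral_mono hB).trans_eq (by simp)

end Family

/-! ### Bounds at `θ` for trigonometric polynomials of admissible functions. -/

namespace InterpolationCouple.Adm

open ProbabilityTheory

variable {X₀ X₁ V : Type*}
  [NormedAddCommGroup X₀] [NormedSpace ℂ X₀] [NormedAddCommGroup X₁] [NormedSpace ℂ X₁]
  [AddCommGroup V] [Module ℂ V] [TopologicalSpace V]
  [IsTopologicalAddGroup V] [T2Space V] {c : InterpolationCouple X₀ X₁ V}

/-- For fixed `t` the polynomial is a single admissible function, so the geometric mean bound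
applies pointwise. Hölder in `t` separates the two means, and Minkowski moves the torus norms inside
them. -/
theorem exists_torusLpNorm_eval_le (c : InterpolationCouple X₀ X₁ V) (θ : Set.Ioo (0 : ℝ) 1) :
    ∃ C : ℝ≥0, ∀ p₀ p₁ p : ℝ≥0∞, InterpExponent θ p₀ p₁ p → p₀ ≠ ∞ → p₁ ≠ ∞ →
      ∀ F : ℤ →₀ c.Adm, torusLpNorm p (trigPoly (mapCoeff (eval c θ) F)) ≤
        C * ((∫⁻ τ, torusLpNorm p₀ (trigPoly (mapCoeff (left c τ) F)) ∂(gaussianReal 0 1)) ^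
            (1 - (θ : ℝ)) *
          (∫⁻ τ, torusLpNorm p₁ (trigPoly (mapCoeff (right c τ) F)) ∂(gaussianReal 0 1)) ^
            (θ : ℝ)) := by
  obtain ⟨C, hC⟩ := exists_enorm_eval_le c θ
  refine ⟨C, fun p₀ p₁ p h ht₀ ht₁ F => ?_⟩
  have ht : p ≠ ∞ := fun e => ht₀ (h.eq_top_iff.1 e).1
  have h1 : 0 ≤ 1 - (θ : ℝ) := sub_nonneg.2 θ.2.2.le
  have h2 : 0 ≤ (θ : ℝ) := θ.2.1.le
  rw [torusLpNorm_eq_extNorm h.one_le ht]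
  have hpt : ∀ t, ‖trigPoly (mapCoeff (eval c θ) F) t‖ₑ ≤
      C * ((∫⁻ τ, ‖trigPoly (mapCoeff (left c τ) F) t‖ₑ ∂(gaussianReal 0 1)) ^ (1 - (θ : ℝ)) *
        (∫⁻ τ, ‖trigPoly (mapCoeff (right c τ) F) t‖ₑ ∂(gaussianReal 0 1)) ^ (θ : ℝ)) := fun t => by
    simp only [trigPoly_mapCoeff]
    exact hC _
  have m0 : Measurable fun t => ∫⁻ τ, ‖trigPoly (mapCoeff (left c τ) F) t‖ₑ ∂(gaussianReal 0 1) :=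
    (continuous_trigPoly_family continuous_left F).enorm.measurable.lintegral_prod_right'
  have m1 : Measurable fun t => ∫⁻ τ, ‖trigPoly (mapCoeff (right c τ) F) t‖ₑ ∂(gaussianReal 0 1) :=
    (continuous_trigPoly_family continuous_right F).enorm.measurable.lintegral_prod_right'
  refine (extNorm_mono _ _ hpt).trans ?_
  rw [extNorm_const_mul _ h.one_le ENNReal.coe_ne_top]
  gcongr
  refine (extNorm_geomMean_le _ h _ _ m0 m1).trans ?_
  gcongr
  · exact extNorm_lintegral_trigPoly_le continuous_left (fun m => ⟨_, norm_left_le m⟩)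
      h.one_le₀ ht₀ F
  · exact extNorm_lintegral_trigPoly_le continuous_right (fun m => ⟨_, norm_right_le m⟩)
      h.one_le₁ ht₁ F

/-- The same Hölder and Minkowski argument once more, now in the index `i`. A common bound `B` on
both sides survives because `B^(1-θ) B^θ = B`. -/
theorem exists_seqNorm_eval_le (c : InterpolationCouple X₀ X₁ V) (θ : Set.Ioo (0 : ℝ) 1) :
    ∃ C : ℝ≥0, ∀ p₀ p₁ p q₀ q₁ q : ℝ≥0∞, InterpExponent θ p₀ p₁ p → p₀ ≠ ∞ → p₁ ≠ ∞ →
      InterpExponent θ q₀ q₁ q → ∀ (ι : Type) [Countable ι] (F : ι → ℤ →₀ c.Adm),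
      {i | F i ≠ 0}.Finite → ∀ B : ℝ≥0∞,
      (∀ τ, seqNorm q₀ (fun i => torusLpNorm p₀ (trigPoly (mapCoeff (left c τ) (F i)))) ≤ B) →
      (∀ τ, seqNorm q₁ (fun i => torusLpNorm p₁ (trigPoly (mapCoeff (right c τ) (F i)))) ≤ B) →
      seqNorm q (fun i => torusLpNorm p (trigPoly (mapCoeff (eval c θ) (F i)))) ≤ C * B := by
  obtain ⟨C, hC⟩ := exists_torusLpNorm_eval_le c θ
  refine ⟨C, fun p₀ p₁ p q₀ q₁ q hp ht₀ ht₁ hq ι _ F hF B hB₀ hB₁ => ?_⟩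
  have h1 : 0 ≤ 1 - (θ : ℝ) := sub_nonneg.2 θ.2.2.le
  have h2 : 0 ≤ (θ : ℝ) := θ.2.1.le
  have b0 := seqNorm_lintegral_trigPoly_le continuous_left (fun m => ⟨_, norm_left_le m⟩)
    hp.one_le₀ ht₀ hq.one_le₀ hF hB₀
  have b1 := seqNorm_lintegral_trigPoly_le continuous_right (fun m => ⟨_, norm_right_le m⟩)
    hp.one_le₁ ht₁ hq.one_le₁ hF hB₁
  let _ : MeasurableSpace ι := ⊤
  simp only [seqNorm_eq_extNorm] at b0 b1 ⊢
  refine (extNorm_mono _ _ fun i => hC p₀ p₁ p hp ht₀ ht₁ (F i)).trans ?_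
  rw [extNorm_const_mul _ hq.one_le ENNReal.coe_ne_top]
  gcongr
  refine (extNorm_geomMean_le _ hq _ _ measurable_from_top measurable_from_top).trans ?_
  calc _ ≤ B ^ (1 - (θ : ℝ)) * B ^ (θ : ℝ) := by gcongr
    _ = B := by
      rw [← ENNReal.rpow_add_of_nonneg _ _ h1 h2, sub_add_cancel, ENNReal.rpow_one]

end InterpolationCouple.Adm

/-! ### Sampling of trigonometric polynomials -/

section Sampling

variable {E E' X : Type*} [AddCommGroup E] [Module ℂ E] [AddCommGroup E'] [Module ℂ E']
  [NormedAddCommGroup X] [NormedSpace ℂ X]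

theorem fourier_apply_add (n : ℤ) (u v : UnitAddCircle) :
    (fourier n (u + v) : ℂ) = fourier n u * fourier n v := by
  simp only [fourier_apply, smul_add, AddCircle.toCircle_add, Circle.coe_mul]

theorem fourier_apply_neg (n : ℤ) (u : UnitAddCircle) :
    (fourier n (-u) : ℂ) = fourier (-n) u := by
  simp only [fourier_apply, smul_neg, neg_smul]

/-- The equidistant nodes `u + k / N`. -/
def node (N : ℕ) (u : UnitAddCircle) (k : Fin N) : UnitAddCircle :=
  u + ((k / N : ℝ) : UnitAddCircle)

/-- A geometric sum over powers of an `N`-th root of unity, which differs from `1` because `N` does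
not divide `n`. -/
theorem sum_fourier_node {N : ℕ} (hN : 0 < N) (u : UnitAddCircle) {n : ℤ} (hn : |n| < N) :
    ∑ k : Fin N, (fourier n (node N u k) : ℂ) = if n = 0 then (N : ℂ) else 0 := by
  split_ifs with h
  · simp [h]
  have hN' : (N : ℂ) ≠ 0 := by exact_mod_cast hN.ne'
  set ζ : ℂ := cexp (2 * Real.pi * I * (n / N)) with hζ
  have hpow : ∀ k : ℕ, (fourier n (((k / N : ℝ)) : UnitAddCircle) : ℂ) = ζ ^ k := fun k => by
    rw [fourier_coe_apply, hζ, ← Complex.exp_nat_mul]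
    congr 1
    push_cast
    field_simp
  have hζN : ζ ^ N = 1 := by
    rw [hζ, ← Complex.exp_nat_mul]
    refine Complex.exp_eq_one_iff.2 ⟨n, ?_⟩
    field_simp
  have hζ1 : ζ ≠ 1 := by
    intro e
    obtain ⟨m, hm⟩ := Complex.exp_eq_one_iff.1 e
    have hpi := Complex.two_pi_I_ne_zero
    rw [mul_comm (m : ℂ)] at hm
    have hm' := mul_left_cancel₀ hpi hm
    rw [div_eq_iff hN'] at hm'
    have hm'' : n = m * N := by exact_mod_cast hm'
    have hdvd : (N : ℤ) ∣ n := ⟨m, by rw [hm'', mul_comm]⟩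
    exact h (Int.eq_zero_of_abs_lt_dvd hdvd hn)
  have hsum : ∑ k ∈ Finset.range N, ζ ^ k = 0 := by
    have := geom_sum_mul ζ N
    rw [hζN, sub_self] at this
    exact (mul_eq_zero.1 this).resolve_right (sub_ne_zero.2 hζ1)
  calc ∑ k : Fin N, (fourier n (node N u k) : ℂ)
      = ∑ k : Fin N, (fourier n u : ℂ) * ζ ^ (k : ℕ) := by
        refine Finset.sum_congr rfl fun k _ => ?_
        rw [node, fourier_apply_add, hpow]
    _ = 0 := by
        rw [← Finset.mul_sum, Fin.sum_univ_eq_sum_range (fun k => ζ ^ k), hsum, mul_zero]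

/-- The Dirichlet kernel of a finite set of frequencies. -/
def dirichletSum (J : Finset ℤ) (u : UnitAddCircle) : ℂ := ∑ j ∈ J, (fourier j u : ℂ)

theorem continuous_dirichletSum (J : Finset ℤ) : Continuous (dirichletSum J) := by
  unfold dirichletSum
  fun_prop

theorem normSq_dirichletSum (J : Finset ℤ) (u : UnitAddCircle) :
    ((‖dirichletSum J u‖ ^ 2 : ℝ) : ℂ) = ∑ i ∈ J, ∑ j ∈ J, (fourier (j - i) (-u) : ℂ) := by
  have : ((‖dirichletSum J u‖ ^ 2 : ℝ) : ℂ) =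
      dirichletSum J u * starRingEnd ℂ (dirichletSum J u) := by
    rw [Complex.mul_conj, Complex.normSq_eq_norm_sq]
  rw [this, dirichletSum, map_sum, Finset.sum_mul_sum]
  refine Finset.sum_congr rfl fun i _ => Finset.sum_congr rfl fun j _ => ?_
  rw [← fourier_neg, ← fourier_add]
  simp only [fourier_apply]
  congr 2
  rw [smul_neg, ← neg_smul]
  congr 1
  ring

/-- Discrete Parseval: the nodes resolve all frequency differences in `J`, so only the diagonal
remains. -/
theorem sum_normSq_dirichletSum {N : ℕ} (hN : 0 < N) (J : Finset ℤ)
    (hJ : ∀ i ∈ J, ∀ j ∈ J, |j - i| < N) (u t : UnitAddCircle) :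
    ∑ k : Fin N, ‖dirichletSum J (t - node N u k)‖ ^ 2 = N * J.card := by
  have hnode : ∀ k, -(t - node N u k) = node N (u - t) k := fun k => by
    simp only [node]; abel
  have : ((∑ k : Fin N, ‖dirichletSum J (t - node N u k)‖ ^ 2 : ℝ) : ℂ) =
      ((N * J.card : ℝ) : ℂ) := by
    rw [Complex.ofReal_sum]
    simp only [normSq_dirichletSum, hnode]
    rw [Finset.sum_comm]
    calc _ = ∑ i ∈ J, ∑ j ∈ J, (if j = i then (N : ℂ) else 0) := by
          refine Finset.sum_congr rfl fun i hi => ?_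
          rw [Finset.sum_comm]
          refine Finset.sum_congr rfl fun j hj => ?_
          rw [sum_fourier_node hN _ (hJ i hi j hj)]
          simp [sub_eq_zero]
      _ = _ := by
          simp [mul_comm]
  exact_mod_cast this

/-- The trigonometric polynomial with given values `y k` at the nodes `s k`, obtained by summation
against a de la Vallée-Poussin kernel. -/
def sampleCoeff (d : ℕ) {N : ℕ} (s : Fin N → UnitAddCircle) (y : Fin N → E) : ℤ →₀ E :=
  ∑ k, ∑ i ∈ Finset.Icc (-(2 * d) : ℤ) 0, ∑ j ∈ Finset.Icc (-d : ℤ) (3 * d),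
    Finsupp.single (i + j)
      ((((N : ℂ) * (2 * d + 1))⁻¹ * (fourier (i + j) (-s k) : ℂ)) • y k)

theorem mapCoeff_sampleCoeff (L : E →ₗ[ℂ] E') (d : ℕ) {N : ℕ} (s : Fin N → UnitAddCircle)
    (y : Fin N → E) :
    mapCoeff L (sampleCoeff d s y) = sampleCoeff d s fun k => L (y k) := by
  simp only [sampleCoeff, map_sum, mapCoeff_single, map_smul]

/-- For `|m| ≤ d`, every `i` in `[-2d, 0]` has exactly one partner `j = m - i` in `[-d, 3d]`, so the
kernel has coefficient `(2d+1)/(2d+1) = 1` at `m`. The kernel lives on `[-3d, 3d]`, so `N > 4d`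
excludes aliasing. -/
theorem sampleCoeff_trigPoly {d N : ℕ} (hN : 4 * d < N) (u : UnitAddCircle) {a : ℤ →₀ X}
    (ha : ∀ m ∈ a.support, |m| ≤ d) :
    sampleCoeff d (node N u) (fun k => trigPoly a (node N u k)) = a := by
  have hN0 : 0 < N := by omega
  have hNc : (N : ℂ) ≠ 0 := by exact_mod_cast hN0.ne'
  have hM : (2 * d + 1 : ℂ) ≠ 0 := by exact_mod_cast (by omega : 2 * d + 1 ≠ 0)
  have hinner : ∀ i j : ℤ, ∀ k : Fin N,
      ((((N : ℂ) * (2 * d + 1))⁻¹ * (fourier (i + j) (-node N u k) : ℂ)) •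
        trigPoly a (node N u k)) =
      ∑ m ∈ a.support, (((N : ℂ) * (2 * d + 1))⁻¹ *
        (fourier (m - (i + j)) (node N u k) : ℂ)) • a m := by
    intro i j k
    rw [trigPoly_eq_sum, Finset.smul_sum]
    refine Finset.sum_congr rfl fun m _ => ?_
    rw [smul_smul, mul_assoc]
    congr 2
    rw [fourier_apply_neg, ← fourier_add, neg_add_eq_sub]
  have hij : ∀ i ∈ Finset.Icc (-(2 * d) : ℤ) 0, ∀ j ∈ Finset.Icc (-d : ℤ) (3 * d),
      ∑ k : Fin N, Finsupp.single (i + j)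
        ((((N : ℂ) * (2 * d + 1))⁻¹ * (fourier (i + j) (-node N u k) : ℂ)) •
          trigPoly a (node N u k)) =
      ∑ m ∈ a.support, if j = m - i then Finsupp.single m ((2 * d + 1 : ℂ)⁻¹ • a m) else 0 := by
    intro i hi j hj
    rw [Finset.mem_Icc] at hi hj
    simp only [hinner]
    rw [← Finsupp.single_finsetSum, Finset.sum_comm, Finsupp.single_finsetSum]
    refine Finset.sum_congr rfl fun m hm => ?_
    have hm' := abs_le.1 (ha m hm)
    rw [← Finset.sum_smul, ← Finset.mul_sum, sum_fourier_node hN0 u (by rw [abs_lt]; omega)]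
    by_cases h : j = m - i
    · rw [if_pos h, if_pos (by omega), h, add_sub_cancel]
      congr 2
      field_simp
    · rw [if_neg h, if_neg (by omega)]
      simp
  have hi : ∀ i ∈ Finset.Icc (-(2 * d) : ℤ) 0, ∑ j ∈ Finset.Icc (-d : ℤ) (3 * d),
      ∑ k : Fin N, Finsupp.single (i + j)
        ((((N : ℂ) * (2 * d + 1))⁻¹ * (fourier (i + j) (-node N u k) : ℂ)) •
          trigPoly a (node N u k)) =
      ∑ m ∈ a.support, Finsupp.single m ((2 * d + 1 : ℂ)⁻¹ • a m) := by
    intro i hi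
    rw [Finset.sum_congr rfl (hij i hi), Finset.sum_comm]
    refine Finset.sum_congr rfl fun m hm => ?_
    have hm' := abs_le.1 (ha m hm)
    rw [Finset.mem_Icc] at hi
    rw [Finset.sum_ite_eq', if_pos (by rw [Finset.mem_Icc]; omega)]
  calc sampleCoeff d (node N u) (fun k => trigPoly a (node N u k))
      = ∑ i ∈ Finset.Icc (-(2 * d) : ℤ) 0, ∑ j ∈ Finset.Icc (-d : ℤ) (3 * d),
          ∑ k : Fin N, Finsupp.single (i + j)
            ((((N : ℂ) * (2 * d + 1))⁻¹ * (fourier (i + j) (-node N u k) : ℂ)) •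
              trigPoly a (node N u k)) := by
        rw [sampleCoeff, Finset.sum_comm]
        exact Finset.sum_congr rfl fun i _ => Finset.sum_comm
    _ = ∑ m ∈ a.support, Finsupp.single m (a m) := by
        rw [Finset.sum_congr rfl hi, Finset.sum_const, Int.card_Icc, Finset.smul_sum]
        refine Finset.sum_congr rfl fun m _ => ?_
        rw [Finsupp.smul_single, ← Nat.cast_smul_eq_nsmul ℂ, smul_smul]
        have : (((0 + 1 - -(2 * d : ℤ)).toNat : ℕ) : ℂ) = 2 * d + 1 := by
          rw [show (0 + 1 - -(2 * d : ℤ)).toNat = 2 * d + 1 by omega]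
          push_cast; ring
        rw [this, mul_inv_cancel₀ hM, one_smul]
    _ = a := Finsupp.sum_single a

/-- A non-negative majorant of the de la Vallée-Poussin kernel. -/
def sampleKernel (d : ℕ) (u : UnitAddCircle) : ℝ :=
  (‖dirichletSum (Finset.Icc (-(2 * d) : ℤ) 0) u‖ ^ 2 +
    ‖dirichletSum (Finset.Icc (-d : ℤ) (3 * d)) u‖ ^ 2) / (2 * (2 * d + 1))

theorem sampleKernel_nonneg (d : ℕ) (u : UnitAddCircle) : 0 ≤ sampleKernel d u := by
  unfold sampleKernel; positivity

theorem continuous_sampleKernel (d : ℕ) : Continuous (sampleKernel d) := by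
  unfold sampleKernel
  have := continuous_dirichletSum (Finset.Icc (-(2 * d) : ℤ) 0)
  have := continuous_dirichletSum (Finset.Icc (-d : ℤ) (3 * d))
  fun_prop

/-- The two index sets have `2d+1` and `4d+1` elements, so discrete Parseval gives `N
(6d+2)/(4d+2)`. -/
theorem sum_sampleKernel_le {d N : ℕ} (hN : 4 * d < N) (u t : UnitAddCircle) :
    ∑ k, sampleKernel d (t - node N u k) ≤ 2 * N := by
  have hN0 : 0 < N := by omega
  simp only [sampleKernel]
  rw [← Finset.sum_div, Finset.sum_add_distrib, sum_normSq_dirichletSum hN0,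
    sum_normSq_dirichletSum hN0]
  · rw [Int.card_Icc, Int.card_Icc,
      show (0 + 1 - -(2 * d : ℤ)).toNat = 2 * d + 1 by omega,
      show (3 * d + 1 - -(d : ℤ)).toNat = 4 * d + 1 by omega, div_le_iff₀ (by positivity)]
    push_cast
    have : (0 : ℝ) ≤ N * d := by positivity
    nlinarith
  · intro i hi j hj
    rw [Finset.mem_Icc] at hi hj
    rw [abs_lt]; omega
  · intro i hi j hj
    rw [Finset.mem_Icc] at hi hj
    rw [abs_lt]; omega

/-- The kernel is a product of two Dirichlet sums, estimated by half the sum of their squares. -/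
theorem norm_trigPoly_sampleCoeff_le (d : ℕ) {N : ℕ} (s : Fin N → UnitAddCircle) (y : Fin N → X)
    (t : UnitAddCircle) :
    ‖trigPoly (sampleCoeff d s y) t‖ ≤ ∑ k, (N : ℝ)⁻¹ * sampleKernel d (t - s k) * ‖y k‖ := by
  have h : trigPoly (sampleCoeff d s y) t =
      ∑ k, (((N : ℂ) * (2 * d + 1))⁻¹ * (dirichletSum (Finset.Icc (-(2 * d) : ℤ) 0) (t - s k) *
        dirichletSum (Finset.Icc (-d : ℤ) (3 * d)) (t - s k))) • y k := by
    simp only [sampleCoeff, trigPoly_sum, Finset.sum_apply, trigPoly_single]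
    refine Finset.sum_congr rfl fun k _ => ?_
    rw [dirichletSum, dirichletSum, Finset.sum_mul_sum, Finset.mul_sum, Finset.sum_smul]
    refine Finset.sum_congr rfl fun i _ => ?_
    rw [Finset.mul_sum, Finset.sum_smul]
    refine Finset.sum_congr rfl fun j _ => ?_
    rw [smul_smul, mul_left_comm, ← fourier_add, sub_eq_add_neg, fourier_apply_add]
  rw [h]
  refine norm_sum_le_of_le _ fun k _ => ?_
  rw [norm_smul]
  gcongr
  rw [norm_mul, norm_mul, norm_inv, norm_mul, sampleKernel, mul_inv, mul_assoc]
  have e : ‖(2 * d + 1 : ℂ)‖ = 2 * d + 1 := by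
    have : (2 * d + 1 : ℂ) = ((2 * d + 1 : ℝ) : ℂ) := by push_cast; ring
    rw [this, Complex.norm_of_nonneg (by positivity)]
  rw [e, Complex.norm_natCast]
  gcongr
  rw [inv_mul_le_iff₀ (by positivity)]
  have h2 := two_mul_le_add_sq (‖dirichletSum (Finset.Icc (-(2 * d) : ℤ) 0) (t - s k)‖)
    (‖dirichletSum (Finset.Icc (-d : ℤ) (3 * d)) (t - s k)‖)
  field_simp
  linarith

/-- The normalised counting measure. -/
def uniformFin (N : ℕ) : Measure (Fin N) := (N : ℝ≥0∞)⁻¹ • Measure.count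

theorem lintegral_uniformFin (N : ℕ) (f : Fin N → ℝ≥0∞) :
    ∫⁻ k, f k ∂(uniformFin N) = ∑ k, (N : ℝ≥0∞)⁻¹ * f k := by
  rw [uniformFin, lintegral_smul_measure, lintegral_count, tsum_fintype, smul_eq_mul,
    Finset.mul_sum]

theorem sum_sampleKernel_le' {d N : ℕ} (hN : 4 * d < N) (u t : UnitAddCircle) :
    ∑ k, (N : ℝ≥0∞)⁻¹ * ENNReal.ofReal (sampleKernel d (t - node N u k)) ≤ 2 := by
  have hN0 : 0 < N := by omega
  have hNe : (N : ℝ≥0∞) ≠ 0 := by exact_mod_cast hN0.ne'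
  rw [← Finset.mul_sum, ← ENNReal.ofReal_sum_of_nonneg fun _ _ => sampleKernel_nonneg _ _]
  calc _ ≤ (N : ℝ≥0∞)⁻¹ * ENNReal.ofReal (2 * N) := by
        gcongr
        exact sum_sampleKernel_le hN u t
    _ = 2 := by
        rw [ENNReal.ofReal_mul two_pos.le, ENNReal.ofReal_natCast, mul_left_comm,
          ENNReal.inv_mul_cancel hNe (ENNReal.natCast_ne_top N)]
        simp

/-- By translation invariance the integral is that of the average of the kernel over nodes, which is
at most `2` pointwise. -/
theorem lintegral_sampleKernel_le (d : ℕ) (v : UnitAddCircle) :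
    ∫⁻ t, ENNReal.ofReal (sampleKernel d (t - v)) ∂AddCircle.haarAddCircle ≤ 2 := by
  set N := 4 * d + 1 with hN
  have hNe : (N : ℝ≥0∞) ≠ 0 := by exact_mod_cast (by omega : N ≠ 0)
  set J := ∫⁻ t, ENNReal.ofReal (sampleKernel d t) ∂AddCircle.haarAddCircle
  have hJ : ∀ v, ∫⁻ t, ENNReal.ofReal (sampleKernel d (t - v)) ∂AddCircle.haarAddCircle = J :=
    fun v => lintegral_sub_right_eq_self (fun t => ENNReal.ofReal (sampleKernel d t)) v
  rw [hJ]
  calc J = ∑ k : Fin N, (N : ℝ≥0∞)⁻¹ * J := by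
        rw [Finset.sum_const, Finset.card_univ, Fintype.card_fin, nsmul_eq_mul, ← mul_assoc,
          ENNReal.mul_inv_cancel hNe (ENNReal.natCast_ne_top N), one_mul]
    _ = ∫⁻ t, ∑ k, (N : ℝ≥0∞)⁻¹ * ENNReal.ofReal (sampleKernel d (t - node N 0 k))
          ∂AddCircle.haarAddCircle := by
        have hm : ∀ k, Measurable fun t => ENNReal.ofReal (sampleKernel d (t - node N 0 k)) :=
          fun k => ((continuous_sampleKernel d).comp
            (continuous_sub_right _)).measurable.ennreal_ofReal
        rw [lintegral_finsetSum _ fun k _ => (hm k).const_mul _]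
        refine Finset.sum_congr rfl fun k _ => ?_
        rw [lintegral_const_mul _ (hm k), hJ]
    _ ≤ ∫⁻ _, 2 ∂(AddCircle.haarAddCircle (T := 1)) :=
        lintegral_mono fun t => sum_sampleKernel_le' (by omega) 0 t
    _ = 2 := by simp

/-- A Schur test: the kernel has mass at most `2` both in the node and in `t`, giving `2^(1-1/p)
2^(1/p) = 2`. The bound holds for every `p`, so the same nodes serve `p₀` and `p₁`. -/
theorem torusLpNorm_sampleCoeff_le {d N : ℕ} (hN : 4 * d < N) (u : UnitAddCircle) {p : ℝ≥0∞}
    (h1 : 1 ≤ p) (h2 : p ≠ ∞) (y : Fin N → X) :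
    torusLpNorm p (trigPoly (sampleCoeff d (node N u) y)) ≤
      2 * extNorm (uniformFin N) p fun k => ‖y k‖ₑ := by
  rw [torusLpNorm_eq_extNorm h1 h2, extNorm_of_ne_top _ h2, extNorm_of_ne_top _ h2,
    lintegral_uniformFin]
  have hp0 := toReal_pos_of_one_le h1 h2
  have hp1 : 1 ≤ p.toReal := by simpa using ENNReal.toReal_mono h2 h1
  set r := p.toReal
  set W : Fin N → UnitAddCircle → ℝ≥0∞ := fun k t =>
    (N : ℝ≥0∞)⁻¹ * ENNReal.ofReal (sampleKernel d (t - node N u k)) with hW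
  have hm : ∀ k, Measurable fun t => ENNReal.ofReal (sampleKernel d (t - node N u k)) :=
    fun k => ((continuous_sampleKernel d).comp
      (continuous_sub_right _)).measurable.ennreal_ofReal
  have hpt : ∀ t, ‖trigPoly (sampleCoeff d (node N u) y) t‖ₑ ^ r ≤
      2 ^ (r - 1) * ∑ k, W k t * ‖y k‖ₑ ^ r := fun t => by
    have e1 : ‖trigPoly (sampleCoeff d (node N u) y) t‖ₑ ≤ ∑ k, W k t * ‖y k‖ₑ := by
      rw [← ofReal_norm]
      refine (ENNReal.ofReal_le_ofReal (norm_trigPoly_sampleCoeff_le d (node N u) y t)).trans_eq ?_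
      rw [ENNReal.ofReal_sum_of_nonneg fun k _ => by
        have := sampleKernel_nonneg d (t - node N u k); positivity]
      refine Finset.sum_congr rfl fun k _ => ?_
      have hN0 : 0 < (N : ℝ) := by exact_mod_cast (by omega : 0 < N)
      rw [ENNReal.ofReal_mul (mul_nonneg (by positivity) (sampleKernel_nonneg _ _)),
        ENNReal.ofReal_mul (by positivity), ENNReal.ofReal_inv_of_pos hN0,
        ENNReal.ofReal_natCast, ofReal_norm]
    have e2 := ENNReal.inner_le_weight_mul_Lp_of_nonneg Finset.univ hp1
      (fun k => W k t) (fun k => ‖y k‖ₑ)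
    have e3 : ‖trigPoly (sampleCoeff d (node N u) y) t‖ₑ ≤
        2 ^ (1 - r⁻¹) * (∑ k, W k t * ‖y k‖ₑ ^ r) ^ r⁻¹ := by
      refine e1.trans (e2.trans ?_)
      gcongr
      · exact sub_nonneg.2 (inv_le_one_of_one_le₀ hp1)
      · exact sum_sampleKernel_le' hN u t
    refine (ENNReal.rpow_le_rpow e3 hp0.le).trans_eq ?_
    rw [ENNReal.mul_rpow_of_nonneg _ _ hp0.le, ← ENNReal.rpow_mul, ← ENNReal.rpow_mul,
      inv_mul_cancel₀ hp0.ne', ENNReal.rpow_one, sub_mul, one_mul, inv_mul_cancel₀ hp0.ne']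
  calc _ ≤ (∫⁻ t, 2 ^ (r - 1) * ∑ k, W k t * ‖y k‖ₑ ^ r ∂AddCircle.haarAddCircle) ^ (1 / r) := by
        gcongr with t
        exact hpt t
    _ ≤ (2 ^ (r - 1) * ∑ k, 2 * ((N : ℝ≥0∞)⁻¹ * ‖y k‖ₑ ^ r)) ^ (1 / r) := by
        have hmW : ∀ k, Measurable (W k) := fun k => (hm k).const_mul _
        rw [lintegral_const_mul _ (Finset.measurable_fun_sum _ fun k _ => (hmW k).mul_const _),
          lintegral_finsetSum _ fun k _ => (hmW k).mul_const _]
        gcongr with k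
        rw [lintegral_mul_const _ (hmW k), hW]
        dsimp only
        rw [lintegral_const_mul _ (hm k), mul_left_comm, mul_assoc]
        gcongr
        exact lintegral_sampleKernel_le d _
    _ = _ := by
        rw [← Finset.mul_sum, ← mul_assoc, ENNReal.mul_rpow_of_nonneg _ _ (by positivity)]
        congr 1
        nth_rewrite 2 [← ENNReal.rpow_one 2]
        rw [← ENNReal.rpow_add _ _ two_ne_zero ENNReal.ofNat_ne_top, sub_add_cancel,
          ← ENNReal.rpow_mul, mul_one_div_cancel hp0.ne', ENNReal.rpow_one]

/-- Averaged over `u`, the `p`-th power of the discrete norm is that of the torus norm, so some `u`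
does not exceed the average. -/
theorem exists_extNorm_node_le (N : ℕ) (hN : 0 < N) {p : ℝ≥0∞} (h1 : 1 ≤ p) (h2 : p ≠ ∞)
    (a : ℤ →₀ X) : ∃ u : UnitAddCircle,
      extNorm (uniformFin N) p (fun k => ‖trigPoly a (node N u k)‖ₑ) ≤
        torusLpNorm p (trigPoly a) := by
  have hNe : (N : ℝ≥0∞) ≠ 0 := by exact_mod_cast hN.ne'
  have hm : ∀ v : UnitAddCircle, Measurable fun u => ‖trigPoly a (u + v)‖ₑ ^ p.toReal := fun v =>
    ((continuous_trigPoly a).comp (continuous_add_const v)).enorm.measurable.pow_const _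
  have hm' : ∀ k, Measurable fun u => ‖trigPoly a (node N u k)‖ₑ ^ p.toReal := fun k => hm _
  have hmS : Measurable fun u => ∑ k, (N : ℝ≥0∞)⁻¹ * ‖trigPoly a (node N u k)‖ₑ ^ p.toReal :=
    Finset.measurable_fun_sum _ fun k _ => (hm' k).const_mul _
  obtain ⟨u, hu⟩ := exists_le_lintegral (μ := AddCircle.haarAddCircle (T := 1)) hmS.aemeasurable
  refine ⟨u, ?_⟩
  rw [torusLpNorm_eq_extNorm h1 h2, extNorm_of_ne_top _ h2, extNorm_of_ne_top _ h2,
    lintegral_uniformFin]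
  gcongr
  refine hu.trans_eq ?_
  rw [lintegral_finsetSum _ fun k _ => (hm' k).const_mul _]
  have : ∀ k : Fin N, ∫⁻ u, ‖trigPoly a (node N u k)‖ₑ ^ p.toReal ∂AddCircle.haarAddCircle =
      ∫⁻ u, ‖trigPoly a u‖ₑ ^ p.toReal ∂AddCircle.haarAddCircle := fun k =>
    lintegral_add_right_eq_self (fun u => ‖trigPoly a u‖ₑ ^ p.toReal) _
  simp only [lintegral_const_mul _ (hm' _), this]
  rw [Finset.sum_const, Finset.card_univ, Fintype.card_fin, nsmul_eq_mul, ← mul_assoc,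
    ENNReal.mul_inv_cancel hNe (ENNReal.natCast_ne_top N), one_mul]

end Sampling

/-! ### Lifting polynomials to admissible families. -/

namespace InterpolationCouple.Adm

variable {X₀ X₁ V : Type*}
  [NormedAddCommGroup X₀] [NormedSpace ℂ X₀] [NormedAddCommGroup X₁] [NormedSpace ℂ X₁]
  [AddCommGroup V] [Module ℂ V] [TopologicalSpace V]
  [IsTopologicalAddGroup V] [T2Space V] {c : InterpolationCouple X₀ X₁ V}

/-- Every trigonometric polynomial with values in the interpolation space is the value at `θ` of an
admissible family of trigonometric polynomials whose boundary values are controlled. -/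
theorem exists_lift {θ : Set.Ioo (0 : ℝ) 1} {p₀ p₁ p : ℝ≥0∞} (h : InterpExponent θ p₀ p₁ p)
    (ht₀ : p₀ ≠ ∞) (ht₁ : p₁ ≠ ∞) {R : ℝ} (hR : 0 < R)
    (a : ℤ →₀ c.InterpSpace θ) :
    ∃ F : ℤ →₀ c.Adm, mapCoeff (eval c θ) F = a ∧
      (∀ τ, torusLpNorm p₀ (trigPoly (mapCoeff (left c τ) F)) ≤
        4 * (ENNReal.ofReal (R ^ (-(θ : ℝ))) * torusLpNorm p (trigPoly a))) ∧
      ∀ τ, torusLpNorm p₁ (trigPoly (mapCoeff (right c τ) F)) ≤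
        4 * (ENNReal.ofReal (R ^ (1 - (θ : ℝ))) * torusLpNorm p (trigPoly a)) := by
  have ht : p ≠ ∞ := fun e => ht₀ (h.eq_top_iff.1 e).1
  obtain ⟨d, hd⟩ : ∃ d : ℕ, ∀ m ∈ a.support, |m| ≤ (d : ℤ) :=
    ⟨a.support.sup Int.natAbs, fun m hm => by
      rw [Int.abs_eq_natAbs]
      exact_mod_cast Finset.le_sup (f := Int.natAbs) hm⟩
  set N := 4 * d + 1 with hN
  have hNd : 4 * d < N := by omega
  obtain ⟨u, hu⟩ := exists_extNorm_node_le N (by omega) h.one_le ht a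
  have hrep := sampleCoeff_trigPoly hNd u hd
  set x : Fin N → c.InterpSpace θ := fun k => trigPoly a (node N u k) with hx
  by_cases hx0 : ∀ k, x k = 0
  · have ha : a = 0 := by
      rw [← hrep]
      simp [sampleCoeff, hx0]
    exact ⟨0, by simp [ha], by simp [trigPoly_zero, torusLpNorm_zero],
      by simp [trigPoly_zero, torusLpNorm_zero]⟩
  push Not at hx0
  obtain ⟨k₀, hk₀⟩ := hx0
  have hp0 := toReal_pos_of_one_le h.one_le ht
  have hSt : extNorm (uniformFin N) p (fun k => ‖x k‖ₑ) ≠ ∞ :=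
    ne_top_of_le_ne_top (torusLpNorm_ne_top p a) hu
  have hS0 : extNorm (uniformFin N) p (fun k => ‖x k‖ₑ) ≠ 0 := by
    rw [extNorm_of_ne_top _ ht, lintegral_uniformFin]
    intro e
    rw [ENNReal.rpow_eq_zero_iff_of_pos (by positivity), Finset.sum_eq_zero_iff] at e
    have := e k₀ (Finset.mem_univ _)
    simp [ENNReal.rpow_eq_zero_iff, hk₀, hp0] at this
  set S := (extNorm (uniformFin N) p fun k => ‖x k‖ₑ).toReal with hS
  have hSpos : 0 < S := ENNReal.toReal_pos hS0 hSt
  have hSe : ENNReal.ofReal S = extNorm (uniformFin N) p fun k => ‖x k‖ₑ :=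
    ENNReal.ofReal_toReal hSt
  -- The weights `r k` pass from `p` to `p₀` and `p₁` across the nodes, whereas `R` is a free scale,
  -- later used to pass from `q` to `q₀` and `q₁` across the intervals. The final `4` is `2` from
  -- sampling times `2` from the near-optimal lifts.
  obtain ⟨r, hr, hr0, hr1⟩ := exists_weight (uniformFin N) h (N := fun k => ‖x k‖)
    (fun _ => norm_nonneg _) hSpos (by simp only [ofReal_norm]; exact hSe.ge)
  choose T hT1 hT2 hT3 using fun k => exists_eval_eq (x k)
  choose T' h1 h2 h3 using fun k => exists_rescale θ (mul_pos hR (hr k)) (T k)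
  refine ⟨sampleCoeff d (node N u) T', ?_, fun τ => ?_, fun τ => ?_⟩
  · rw [mapCoeff_sampleCoeff]
    simp only [h1, hT1]
    exact hrep
  · rw [mapCoeff_sampleCoeff]
    refine (torusLpNorm_sampleCoeff_le hNd u h.one_le₀ ht₀ _).trans ?_
    calc _ ≤ 2 * extNorm (uniformFin N) p₀
          fun k => (2 * ENNReal.ofReal (R ^ (-(θ : ℝ)))) *
            ENNReal.ofReal (r k ^ (-(θ : ℝ)) * ‖x k‖) := by
          gcongr
          refine extNorm_mono _ _ fun k => ?_
          rw [← ofReal_norm, h2]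
          refine (ENNReal.ofReal_le_ofReal (mul_le_mul_of_nonneg_left (hT2 k τ)
            (Real.rpow_nonneg (mul_pos hR (hr k)).le _))).trans_eq ?_
          rw [Real.mul_rpow hR.le (hr k).le, mul_left_comm, mul_assoc,
            ENNReal.ofReal_mul two_pos.le, ENNReal.ofReal_ofNat, ENNReal.ofReal_mul (by positivity), mul_assoc]
      _ ≤ 2 * ((2 * ENNReal.ofReal (R ^ (-(θ : ℝ)))) * torusLpNorm p (trigPoly a)) := by
          rw [extNorm_const_mul _ h.one_le₀ (ENNReal.mul_ne_top (by simp) (by simp))]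
          gcongr
          exact hr0.trans (hSe.le.trans hu)
      _ = _ := by rw [mul_assoc 2, ← mul_assoc]; norm_num
  · rw [mapCoeff_sampleCoeff]
    refine (torusLpNorm_sampleCoeff_le hNd u h.one_le₁ ht₁ _).trans ?_
    calc _ ≤ 2 * extNorm (uniformFin N) p₁
          fun k => (2 * ENNReal.ofReal (R ^ (1 - (θ : ℝ)))) *
            ENNReal.ofReal (r k ^ (1 - (θ : ℝ)) * ‖x k‖) := by
          gcongr
          refine extNorm_mono _ _ fun k => ?_
          rw [← ofReal_norm, h3]
          refine (ENNReal.ofReal_le_ofReal (mul_le_mul_of_nonneg_left (hT3 k τ)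
            (Real.rpow_nonneg (mul_pos hR (hr k)).le _))).trans_eq ?_
          rw [Real.mul_rpow hR.le (hr k).le, mul_left_comm, mul_assoc,
            ENNReal.ofReal_mul two_pos.le, ENNReal.ofReal_ofNat, ENNReal.ofReal_mul (by positivity), mul_assoc]
      _ ≤ 2 * ((2 * ENNReal.ofReal (R ^ (1 - (θ : ℝ)))) * torusLpNorm p (trigPoly a)) := by
          rw [extNorm_const_mul _ h.one_le₁ (ENNReal.mul_ne_top (by simp) (by simp))]
          gcongr
          exact hr1.trans (hSe.le.trans hu)
      _ = _ := by rw [mul_assoc 2, ← mul_assoc]; norm_num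

end InterpolationCouple.Adm

/-! ### Projections onto intervals in UMD spaces -/

section Intervals

variable {X : Type*} [NormedAddCommGroup X] [NormedSpace ℂ X]

theorem trigProj_eq (I : Set ℤ) [DecidablePred (· ∈ I)] (a : ℤ →₀ X) :
    trigProj I a = trigPoly (a.filter (· ∈ I)) := by
  rw [trigProj]
  congr!

/-- Translation of the Fourier coefficients. -/
def shiftCoeff (n : ℤ) (a : ℤ →₀ X) : ℤ →₀ X :=
  a.equivMapDomain (Equiv.subRight n)

omit [NormedSpace ℂ X] in
theorem shiftCoeff_apply (n : ℤ) (a : ℤ →₀ X) (m : ℤ) : shiftCoeff n a m = a (m + n) := rfl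

theorem trigPoly_shiftCoeff (n : ℤ) (a : ℤ →₀ X) (t : UnitAddCircle) :
    trigPoly (shiftCoeff n a) t = (fourier (-n) t : ℂ) • trigPoly a t := by
  rw [shiftCoeff, Finsupp.equivMapDomain_eq_mapDomain, trigPoly,
    Finsupp.sum_mapDomain_index (by simp) (by simp [smul_add]), trigPoly, Finsupp.smul_sum]
  refine Finsupp.sum_congr fun m _ => ?_
  rw [smul_smul, ← fourier_add, Equiv.subRight_apply, neg_add_eq_sub]

theorem torusLpNorm_shiftCoeff (p : ℝ≥0∞) (n : ℤ) (a : ℤ →₀ X) :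
    torusLpNorm p (trigPoly (shiftCoeff n a)) = torusLpNorm p (trigPoly a) := by
  refine eLpNorm_congr_norm_ae (ae_of_all _ fun t => ?_)
  rw [trigPoly_shiftCoeff, norm_smul, fourier_apply, Circle.norm_coe, one_mul]

/-- Modulation by `e_(-n)` preserves the norm and moves the half-line to `[0, ∞)`. -/
theorem torusLpNorm_trigProj_Ici_le {p : ℝ≥0∞} {C : ℝ≥0}
    (hC : ∀ a : ℤ →₀ X, torusLpNorm p (trigProj (Set.Ici 0) a) ≤ C * torusLpNorm p (trigPoly a))
    (n : ℤ) (a : ℤ →₀ X) :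
    torusLpNorm p (trigProj (Set.Ici n) a) ≤ C * torusLpNorm p (trigPoly a) := by
  classical
  have h : shiftCoeff n (a.filter (· ∈ Set.Ici n)) =
      (shiftCoeff n a).filter (· ∈ Set.Ici (0 : ℤ)) := by
    ext m
    by_cases hm : 0 ≤ m <;> simp [shiftCoeff_apply, hm]
  have := hC (shiftCoeff n a)
  rw [torusLpNorm_shiftCoeff] at this
  refine le_trans (le_of_eq ?_) this
  rw [trigProj_eq, trigProj_eq, ← torusLpNorm_shiftCoeff p n, h]

/-- In a UMD space, the projections onto intervals are uniformly bounded. -/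
theorem IsUMD.exists_torusLpNorm_trigProj_le (hX : IsUMD X) {p : ℝ≥0∞} (h1 : 1 < p) (h2 : p < ∞) :
    ∃ C : ℝ≥0, ∀ I : Set ℤ, I.OrdConnected → ∀ a : ℤ →₀ X,
      torusLpNorm p (trigProj I a) ≤ C * torusLpNorm p (trigPoly a) := by
  classical
  obtain ⟨C, hC⟩ := hX p h1 h2
  refine ⟨C + C, fun I hI a => ?_⟩
  by_cases hS : (a.support.filter (· ∈ I)).Nonempty
  · set m := (a.support.filter (· ∈ I)).min' hS
    set M := (a.support.filter (· ∈ I)).max' hS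
    have hm : m ∈ I := (Finset.mem_filter.1 (Finset.min'_mem _ hS)).2
    have hM : M ∈ I := (Finset.mem_filter.1 (Finset.max'_mem _ hS)).2
    -- On the support of `a` the interval `I` coincides with `[m, M]`, a difference of two
    -- half-lines.
    have hsplit : trigProj I a + trigProj (Set.Ici (M + 1)) a = trigProj (Set.Ici m) a := by
      rw [trigProj_eq, trigProj_eq, trigProj_eq, ← trigPoly_add]
      congr 1
      ext k
      simp only [Finsupp.add_apply, Finsupp.filter_apply, Set.mem_Ici]
      by_cases hk : a k = 0
      · simp [hk]
      by_cases hkI : k ∈ I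
      · have hkS : k ∈ a.support.filter (· ∈ I) := by simp [hk, hkI]
        have l1 : m ≤ k := Finset.min'_le _ _ hkS
        have l2 : k ≤ M := Finset.le_max' _ _ hkS
        rw [if_pos hkI, if_neg (by omega), if_pos l1, add_zero]
      · rw [if_neg hkI, zero_add]
        by_cases l1 : m ≤ k
        · have l2 : M + 1 ≤ k := by
            by_contra hlt
            exact hkI (hI.out hm hM ⟨l1, by omega⟩)
          rw [if_pos l1, if_pos l2]
        · have : m ≤ M := Finset.min'_le _ _ (Finset.max'_mem _ hS)
          rw [if_neg l1, if_neg (by omega)]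
    rw [← eq_sub_iff_add_eq] at hsplit
    rw [hsplit, ENNReal.coe_add, add_mul]
    refine (eLpNorm_sub_le (continuous_trigPoly _).aestronglyMeasurable
      (continuous_trigPoly _).aestronglyMeasurable h1.le).trans (add_le_add ?_ ?_)
    · exact torusLpNorm_trigProj_Ici_le hC m a
    · exact torusLpNorm_trigProj_Ici_le hC (M + 1) a
  · have : trigProj I a = 0 := by
      rw [trigProj_eq, ← trigPoly_zero]
      congr 1
      ext k
      rw [Finsupp.filter_apply]
      split_ifs with hk
      · by_contra hne
        exact hS ⟨k, by simpa [hk] using hne⟩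
      · rfl
    rw [this, torusLpNorm_zero]
    exact zero_le

end Intervals

/-! ### Partitions -/

section Partitions

open scoped Classical

variable {M : Type*} [AddCommGroup M] {P : Set (Set ℤ)}

theorem IsIntervalPartition.exists_index (hP : IsIntervalPartition P) :
    ∃ g : ℤ → P, Function.Surjective g ∧ ∀ (I : P) (n : ℤ), n ∈ (I : Set ℤ) ↔ g n = I := by
  choose g hg hu using fun n => hP.1.2 n
  have key : ∀ (I : P) (n : ℤ), n ∈ (I : Set ℤ) ↔ (⟨g n, (hg n).1⟩ : P) = I := fun I n =>
    ⟨fun h => Subtype.ext (hu n I ⟨I.2, h⟩).symm, fun h => h ▸ (hg n).2⟩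
  refine ⟨fun n => ⟨g n, (hg n).1⟩, fun I => ?_, key⟩
  obtain ⟨n, hn⟩ : (I : Set ℤ).Nonempty :=
    Set.nonempty_iff_ne_empty.2 fun h => hP.1.1 (h ▸ I.2)
  exact ⟨n, (key I n).1 hn⟩

theorem IsIntervalPartition.countable (hP : IsIntervalPartition P) : Countable P := by
  obtain ⟨g, hg, -⟩ := hP.exists_index
  exact hg.countable

theorem IsIntervalPartition.finite_filter_ne_zero (hP : IsIntervalPartition P) (a : ℤ →₀ M) :
    {I : P | a.filter (· ∈ (I : Set ℤ)) ≠ 0}.Finite := by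
  obtain ⟨g, -, hg⟩ := hP.exists_index
  refine (a.support.finite_toSet.image g).subset fun I hI => ?_
  obtain ⟨n, hn⟩ := Finsupp.ne_iff.1 hI
  rw [Finsupp.filter_apply] at hn
  split_ifs at hn with h
  · exact ⟨n, by simpa using hn, (hg I n).1 h⟩
  · simp at hn

theorem IsIntervalPartition.sum_filter (hP : IsIntervalPartition P) (a : ℤ →₀ M) {s : Finset P}
    (hs : ∀ I : P, a.filter (· ∈ (I : Set ℤ)) ≠ 0 → I ∈ s) :
    ∑ I ∈ s, a.filter (· ∈ (I : Set ℤ)) = a := by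
  obtain ⟨g, -, hg⟩ := hP.exists_index
  ext n
  simp only [Finsupp.finsetSum_apply, Finsupp.filter_apply, hg]
  rw [Finset.sum_ite_eq]
  split_ifs with h
  · rfl
  · by_contra hne
    refine h (hs (g n) (Finsupp.ne_iff.2 ⟨n, ?_⟩))
    rw [Finsupp.filter_apply, if_pos ((hg _ n).2 rfl)]
    simpa using Ne.symm hne

theorem IsIntervalPartition.filter_sum_filter (hP : IsIntervalPartition P) (s : Finset P)
    (F : P → ℤ →₀ M) (J : P) :
    (∑ I ∈ s, (F I).filter (· ∈ (I : Set ℤ))).filter (· ∈ (J : Set ℤ)) =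
      if J ∈ s then (F J).filter (· ∈ (J : Set ℤ)) else 0 := by
  obtain ⟨g, -, hg⟩ := hP.exists_index
  ext n
  by_cases hJ : g n = J
  · subst hJ
    rw [Finsupp.filter_apply, if_pos ((hg _ n).2 rfl)]
    simp only [Finsupp.finsetSum_apply, Finsupp.filter_apply, hg]
    rw [Finset.sum_ite_eq]
    split_ifs with h
    · simp
    · rfl
  · have hn : n ∉ (J : Set ℤ) := fun h => hJ ((hg J n).1 h)
    rw [Finsupp.filter_apply, if_neg hn]
    split_ifs with h
    · rw [Finsupp.filter_apply, if_neg hn]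
    · rfl

theorem seqNorm_mono {ι : Type*} {q : ℝ≥0∞} {x y : ι → ℝ≥0∞} (h : ∀ i, x i ≤ y i) :
    seqNorm q x ≤ seqNorm q y := by
  let _ : MeasurableSpace ι := ⊤
  simp only [seqNorm_eq_extNorm]
  exact extNorm_mono _ _ h

theorem seqNorm_const_mul {ι : Type*} {q : ℝ≥0∞} (hq : 1 ≤ q) {c : ℝ≥0∞} (hc : c ≠ ∞)
    (x : ι → ℝ≥0∞) : seqNorm q (fun i => c * x i) = c * seqNorm q x := by
  let _ : MeasurableSpace ι := ⊤
  simp only [seqNorm_eq_extNorm]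
  exact extNorm_const_mul _ hq hc x

/-- The block `D_J` of `∑ D_I F_I` is `D_J F_J` or zero. Bounded projections thus allow the `F I` to
have frequencies outside `I`, as the sampled lifts do. -/
theorem IsIntervalPartition.torusLpNorm_sum_filter_le [Module ℂ M] {X : Type*}
    [NormedAddCommGroup X] [NormedSpace ℂ X] (hP : IsIntervalPartition P) (T : M →ₗ[ℂ] X)
    (s : Finset P) (F : P → ℤ →₀ M) {p q : ℝ≥0∞} (hq : 1 ≤ q) {U D : ℝ≥0}
    (hU : ∀ a : ℤ →₀ X, torusLpNorm p (trigPoly a) ≤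
      U * seqNorm q (fun I : P => torusLpNorm p (trigProj (I : Set ℤ) a)))
    (hD : ∀ I ∈ P, ∀ a : ℤ →₀ X, torusLpNorm p (trigProj I a) ≤ D * torusLpNorm p (trigPoly a))
    {y : P → ℝ≥0∞} (hy : ∀ I, torusLpNorm p (trigPoly (mapCoeff T (F I))) ≤ 4 * y I) :
    torusLpNorm p (trigPoly (mapCoeff T (∑ I ∈ s, (F I).filter (· ∈ (I : Set ℤ))))) ≤
      (U * (D * 4) : ℝ≥0) * seqNorm q y := by
  refine (hU _).trans ?_
  have hle : ∀ I : P, torusLpNorm p (trigProj (I : Set ℤ)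
      (mapCoeff T (∑ I ∈ s, (F I).filter (· ∈ (I : Set ℤ))))) ≤ (D * 4 : ℝ≥0) * y I := by
    intro I
    rw [trigProj_eq, ← mapCoeff_filter, hP.filter_sum_filter]
    split_ifs with hI
    · rw [mapCoeff_filter, ← trigProj_eq]
      refine (hD I I.2 _).trans ?_
      push_cast
      rw [mul_assoc]
      gcongr
      exact hy I
    · rw [map_zero, trigPoly_zero, torusLpNorm_zero]
      exact zero_le
  rw [ENNReal.coe_mul, mul_assoc]
  exact mul_le_mul' le_rfl
    ((seqNorm_mono hle).trans_eq (seqNorm_const_mul hq ENNReal.coe_ne_top y))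

end Partitions

/-! ### Interpolation of decompositions -/

namespace InterpolationCouple

open Adm

variable {X₀ X₁ V : Type*}
  [NormedAddCommGroup X₀] [NormedSpace ℂ X₀] [NormedAddCommGroup X₁] [NormedSpace ℂ X₁]
  [AddCommGroup V] [Module ℂ V] [TopologicalSpace V]
  [IsTopologicalAddGroup V] [T2Space V]

theorem hasLowerDecompositions (c : InterpolationCouple X₀ X₁ V) {θ : Set.Ioo (0 : ℝ) 1}
    {p₀ p₁ p q₀ q₁ q : ℝ≥0∞} (hp : InterpExponent θ p₀ p₁ p) (ht₀ : p₀ ≠ ∞) (ht₁ : p₁ ≠ ∞)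
    (hq : InterpExponent θ q₀ q₁ q) (h₀ : HasLowerDecompositions X₀ q₀ p₀)
    (h₁ : HasLowerDecompositions X₁ q₁ p₁) : HasLowerDecompositions (c.InterpSpace θ) q p := by
  classical
  obtain ⟨L₀, -, hL₀⟩ := h₀
  obtain ⟨L₁, -, hL₁⟩ := h₁
  obtain ⟨C, hC⟩ := exists_seqNorm_eval_le c θ
  refine ⟨C * (max L₀ L₁ * 4) + 1, by positivity, fun P hP a => ?_⟩
  obtain ⟨F, hF, hF₀, hF₁⟩ := exists_lift hp ht₀ ht₁ one_pos a
  simp only [Real.one_rpow, ENNReal.ofReal_one, one_mul] at hF₀ hF₁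
  have := hP.countable
  have hB := hC p₀ p₁ p q₀ q₁ q hp ht₀ ht₁ hq P (fun I => F.filter (· ∈ (I : Set ℤ)))
    (hP.finite_filter_ne_zero F) ((max L₀ L₁ : ℝ≥0) * (4 * torusLpNorm p (trigPoly a)))
    (fun τ => by
      simp only [mapCoeff_filter, ← trigProj_eq]
      refine (hL₀ P hP (mapCoeff (left c τ) F)).trans (mul_le_mul' ?_ (hF₀ τ))
      exact_mod_cast le_max_left _ _)
    (fun τ => by
      simp only [mapCoeff_filter, ← trigProj_eq]
      refine (hL₁ P hP (mapCoeff (right c τ) F)).trans (mul_le_mul' ?_ (hF₁ τ))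
      exact_mod_cast le_max_right _ _)
  simp only [mapCoeff_filter, hF, ← trigProj_eq] at hB
  calc _ ≤ _ := hB
    _ ≤ _ := by
      push_cast
      rw [add_mul, mul_assoc, mul_assoc]
      exact le_self_add

/-- The sequence estimate for a one-point index set, where all `ℓ^q` norms agree. -/
theorem exists_torusLpNorm_eval_le_of_le (c : InterpolationCouple X₀ X₁ V)
    (θ : Set.Ioo (0 : ℝ) 1) :
    ∃ C : ℝ≥0, ∀ p₀ p₁ p : ℝ≥0∞, InterpExponent θ p₀ p₁ p → p₀ ≠ ∞ → p₁ ≠ ∞ →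
      ∀ (F : ℤ →₀ c.Adm) (B : ℝ≥0∞),
      (∀ τ, torusLpNorm p₀ (trigPoly (mapCoeff (left c τ) F)) ≤ B) →
      (∀ τ, torusLpNorm p₁ (trigPoly (mapCoeff (right c τ) F)) ≤ B) →
      torusLpNorm p (trigPoly (mapCoeff (eval c θ) F)) ≤ C * B := by
  obtain ⟨C, hC⟩ := exists_seqNorm_eval_le c θ
  refine ⟨C, fun p₀ p₁ p hp ht₀ ht₁ F B h0 h1 => ?_⟩
  have he : InterpExponent θ ∞ ∞ ∞ := ⟨θ.2.1, θ.2.2, le_top, le_top, by simp⟩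
  have := hC p₀ p₁ p ∞ ∞ ∞ hp ht₀ ht₁ he Unit (fun _ => F) (Set.toFinite _) B
    (fun τ => by simpa [seqNorm] using h0 τ) (fun τ => by simpa [seqNorm] using h1 τ)
  simpa [seqNorm] using this

theorem hasUpperDecompositions (c : InterpolationCouple X₀ X₁ V) {θ : Set.Ioo (0 : ℝ) 1}
    {p₀ p₁ p q₀ q₁ q : ℝ≥0∞} (hX₀ : IsUMD X₀) (hX₁ : IsUMD X₁) (hp : InterpExponent θ p₀ p₁ p)
    (hp₀ : 1 < p₀) (hp₁ : 1 < p₁) (ht₀ : p₀ < ∞) (ht₁ : p₁ < ∞)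
    (hq : InterpExponent θ q₀ q₁ q) (h₀ : HasUpperDecompositions X₀ q₀ p₀)
    (h₁ : HasUpperDecompositions X₁ q₁ p₁) : HasUpperDecompositions (c.InterpSpace θ) q p := by
  classical
  obtain ⟨U₀, -, hU₀⟩ := h₀
  obtain ⟨U₁, -, hU₁⟩ := h₁
  obtain ⟨D₀, hD₀⟩ := hX₀.exists_torusLpNorm_trigProj_le hp₀ ht₀
  obtain ⟨D₁, hD₁⟩ := hX₁.exists_torusLpNorm_trigProj_le hp₁ ht₁
  obtain ⟨C, hC⟩ := exists_torusLpNorm_eval_le_of_le c θ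
  set K : ℝ≥0 := C * (max (U₀ * (D₀ * 4)) (U₁ * (D₁ * 4))) + 1 with hK
  have hKpos : 0 < K := by positivity
  refine ⟨K, hKpos, fun P hP a => ?_⟩
  set x : P → ℝ≥0∞ := fun I => torusLpNorm p (trigProj (I : Set ℤ) a) with hx
  have hxt : ∀ I, x I ≠ ∞ := fun I => torusLpNorm_ne_top p _
  -- A finite `S` strictly above the norm is automatically positive, as the choice of weights
  -- requires.
  suffices main : ∀ S : ℝ≥0, seqNorm q x < S → torusLpNorm p (trigPoly a) ≤ K * S by
    rcases eq_or_ne (seqNorm q x) ∞ with htop | htop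
    · rw [htop, ENNReal.mul_top (by exact_mod_cast hKpos.ne')]
      exact le_top
    refine ENNReal.le_of_forall_pos_le_add fun ε hε _ => ?_
    have hδ : 0 < ε / K := by positivity
    lift seqNorm q x to ℝ≥0 using htop with S₀
    have := main (S₀ + ε / K) (by exact_mod_cast lt_add_of_pos_right S₀ hδ)
    refine this.trans_eq ?_
    rw [← ENNReal.coe_mul, mul_add, mul_div_cancel₀ _ hKpos.ne']
    push_cast
    rfl
  intro S hS
  let _ : MeasurableSpace P := ⊤
  have hSpos : 0 < (S : ℝ) := by
    have : (0 : ℝ≥0∞) < S := zero_le.trans_lt hS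
    exact_mod_cast this
  obtain ⟨r, hr, hr0, hr1⟩ := exists_weight (α := P) Measure.count hq (N := fun I => (x I).toReal)
    (fun _ => ENNReal.toReal_nonneg) hSpos (by
      simp only [ENNReal.ofReal_toReal (hxt _), ENNReal.ofReal_coe_nnreal, ← seqNorm_eq_extNorm]
      exact hS.le)
  rw [ENNReal.ofReal_coe_nnreal] at hr0 hr1
  have hxr : ∀ (I : P) (e : ℝ), ENNReal.ofReal (r I ^ e * (x I).toReal) =
      ENNReal.ofReal (r I ^ e) * x I := fun I e => by
    rw [ENNReal.ofReal_mul (Real.rpow_nonneg (hr I).le _), ENNReal.ofReal_toReal (hxt I)]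
  simp only [hxr] at hr0 hr1
  choose F hF hF₀ hF₁ using fun I : P =>
    exists_lift hp ht₀.ne ht₁.ne (hr I) (a.filter (· ∈ (I : Set ℤ)))
  have hxI : ∀ I : P, torusLpNorm p (trigPoly (a.filter (· ∈ (I : Set ℤ)))) = x I := fun I => by
    rw [hx]; dsimp only; rw [trigProj_eq]
  simp only [hxI] at hF₀ hF₁
  set s : Finset P := (hP.finite_filter_ne_zero a).toFinset
  set G : ℤ →₀ c.Adm := ∑ I ∈ s, (F I).filter (· ∈ (I : Set ℤ)) with hG
  -- Evaluation commutes with the projections and `F I` evaluates to `D_I a`, so projecting again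
  -- changes nothing at `θ`.
  have hGe : mapCoeff (eval c θ) G = a := by
    rw [hG, map_sum]
    simp only [mapCoeff_filter, hF]
    rw [← hP.sum_filter a (s := s) fun I hI => by simpa [s] using hI]
    refine Finset.sum_congr rfl fun I hI => ?_
    rw [hP.sum_filter a (s := s) fun I hI => by simpa [s] using hI]
    ext n
    by_cases hn : n ∈ (I : Set ℤ) <;> simp [hn]
  have hfinal := hC p₀ p₁ p hp ht₀.ne ht₁.ne G
    ((max (U₀ * (D₀ * 4)) (U₁ * (D₁ * 4)) : ℝ≥0) * S) (fun τ => ?_) fun τ => ?_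
  · rw [hGe] at hfinal
    refine hfinal.trans ?_
    rw [hK, ← mul_assoc, ← ENNReal.coe_mul]
    gcongr
    exact le_self_add
  · refine (hP.torusLpNorm_sum_filter_le (left c τ) s F hq.one_le₀ (hU₀ P hP)
      (fun I hI => hD₀ I (hP.2 I hI)) fun I => hF₀ I τ).trans ?_
    rw [seqNorm_eq_extNorm]
    refine mul_le_mul' ?_ hr0
    exact_mod_cast le_max_left _ _
  · refine (hP.torusLpNorm_sum_filter_le (right c τ) s F hq.one_le₁ (hU₁ P hP)
      (fun I hI => hD₁ I (hP.2 I hI)) fun I => hF₁ I τ).trans ?_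
    rw [seqNorm_eq_extNorm]
    refine mul_le_mul' ?_ hr1
    exact_mod_cast le_max_right _ _

end InterpolationCouple

/-! ### Extrapolation -/

section Isometry

variable {X Y : Type*} [NormedAddCommGroup X] [NormedSpace ℂ X] [NormedAddCommGroup Y]
  [NormedSpace ℂ Y] {p q : ℝ≥0∞}

theorem torusLpNorm_mapCoeff_isometry (J : X →ₗᵢ[ℂ] Y) (a : ℤ →₀ X) :
    torusLpNorm p (trigPoly (mapCoeff J.toLinearMap a)) = torusLpNorm p (trigPoly a) := by
  refine eLpNorm_congr_norm_ae (ae_of_all _ fun t => ?_)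
  rw [trigPoly_mapCoeff]
  exact J.norm_map _

theorem torusLpNorm_trigProj_mapCoeff_isometry (J : X →ₗᵢ[ℂ] Y) (I : Set ℤ) (a : ℤ →₀ X) :
    torusLpNorm p (trigProj I (mapCoeff J.toLinearMap a)) = torusLpNorm p (trigProj I a) := by
  classical
  rw [trigProj_eq, ← mapCoeff_filter, torusLpNorm_mapCoeff_isometry, trigProj_eq]

theorem HasUpperDecompositions.of_isometry (J : X →ₗᵢ[ℂ] Y) (h : HasUpperDecompositions Y q p) :
    HasUpperDecompositions X q p := by
  obtain ⟨U, hU, h⟩ := h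
  refine ⟨U, hU, fun P hP a => ?_⟩
  simpa only [torusLpNorm_mapCoeff_isometry, torusLpNorm_trigProj_mapCoeff_isometry] using
    h P hP (mapCoeff J.toLinearMap a)

theorem HasLowerDecompositions.of_isometry (J : X →ₗᵢ[ℂ] Y) (h : HasLowerDecompositions Y q p) :
    HasLowerDecompositions X q p := by
  obtain ⟨L, hL, h⟩ := h
  refine ⟨L, hL, fun P hP a => ?_⟩
  simpa only [torusLpNorm_mapCoeff_isometry, torusLpNorm_trigProj_mapCoeff_isometry] using
    h P hP (mapCoeff J.toLinearMap a)

theorem hasUpperDecompositions_one (h1 : 1 ≤ p) : HasUpperDecompositions X 1 p := by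
  classical
  refine ⟨1, one_pos, fun P hP a => ?_⟩
  set s := (hP.finite_filter_ne_zero a).toFinset
  have hsum := hP.sum_filter a (s := s) fun I hI => by simpa [s] using hI
  calc torusLpNorm p (trigPoly a)
      = torusLpNorm p (∑ I ∈ s, trigProj (I : Set ℤ) a) := by
        simp only [trigProj_eq, ← trigPoly_sum, hsum]
    _ ≤ ∑ I ∈ s, torusLpNorm p (trigProj (I : Set ℤ) a) :=
        eLpNorm_sum_le (fun I _ => (continuous_trigPoly _).aestronglyMeasurable) h1
    _ ≤ ∑' I : P, torusLpNorm p (trigProj (I : Set ℤ) a) := ENNReal.sum_le_tsum s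
    _ = _ := by simp [seqNorm]

theorem IsUMD.hasLowerDecompositions_top (hX : IsUMD X) (h1 : 1 < p) (h2 : p < ∞) :
    HasLowerDecompositions X ∞ p := by
  obtain ⟨C, hC⟩ := hX.exists_torusLpNorm_trigProj_le h1 h2
  refine ⟨C + 1, by positivity, fun P hP a => ?_⟩
  simp only [seqNorm, if_true]
  refine iSup_le fun I => (hC I (hP.2 I I.2) a).trans ?_
  gcongr
  exact le_self_add

end Isometry

/-! ### The couple `(X, X)`. -/

namespace InterpolationCouple

variable (X : Type*) [NormedAddCommGroup X] [NormedSpace ℂ X]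

/-- The interpolation couple `(X, X)`. -/
def diag : InterpolationCouple X X X where
  emb₀ := .id ℂ X
  emb₁ := .id ℂ X
  emb₀_injective := Function.injective_id
  emb₁_injective := Function.injective_id

theorem diag_incl₀_eq_incl₁ (x : X) : (diag X).incl₀ x = (diag X).incl₁ x := by
  refine (Submodule.Quotient.eq _).2 ?_
  change (diag X).addMap _ = 0
  simp [addMap, diag]

/-- Triangle inequality for every decomposition `x = x₀ + x₁` inside `X`. -/
theorem norm_le_norm_diag_incl₀ (x : X) : ‖x‖ ≤ ‖(diag X).incl₀ x‖ := by
  refine le_of_forall_pos_le_add fun ε hε => ?_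
  obtain ⟨m, hm, hlt⟩ := Submodule.Quotient.norm_mk_lt ((diag X).incl₀ x) hε
  have hk : (diag X).addMap (m - WithLp.toLp 1 (x, (0 : X))) = 0 :=
    (Submodule.Quotient.eq _).1 hm
  have hx : x = m.fst + m.snd := by
    simp only [addMap, diag] at hk
    simp at hk
    rw [sub_add_eq_add_sub] at hk
    exact (sub_eq_zero.1 hk).symm
  calc ‖x‖ ≤ ‖m.fst‖ + ‖m.snd‖ := by rw [hx]; exact norm_add_le _ _
    _ = ‖m‖ := by rw [WithLp.prod_norm_eq_of_L1]
    _ ≤ _ := hlt.le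

/-- The constant functions, as admissible functions. -/
def diagConst : X →ₗ[ℂ] (diag X).Adm where
  toFun x := ⟨(fun _ => (diag X).incl₀ x, .const ℝ x, .const ℝ x),
    { continuousOn := continuousOn_const
      differentiableOn := differentiableOn_const _
      bounded := ⟨‖(diag X).incl₀ x‖, fun _ _ _ => le_rfl⟩
      left := fun _ => rfl
      right := fun _ => diag_incl₀_eq_incl₁ X x }⟩
  map_add' x y := by
    refine Subtype.ext (Prod.ext ?_ (Prod.ext rfl rfl))
    ext z
    exact map_add _ _ _
  map_smul' r x := by
    refine Subtype.ext (Prod.ext ?_ (Prod.ext rfl rfl))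
    ext z
    exact map_smul _ _ _

/-- The isometric embedding of `X` in `[X, X]_θ`. -/
def diagIsometry (θ : Set.Ioo (0 : ℝ) 1) : X →ₗᵢ[ℂ] (diag X).InterpSpace θ where
  toLinearMap := Adm.eval (diag X) θ ∘ₗ diagConst X
  norm_map' x := le_antisymm
    (Adm.norm_eval_le (diagConst X x) (norm_nonneg x) (fun _ => le_rfl) fun _ => le_rfl)
    ((norm_le_norm_diag_incl₀ X x).trans
      (InterpSpace.norm_incl_le (Adm.eval (diag X) θ (diagConst X x))))

end InterpolationCouple

/-! ### Arithmetic of the exponents. -/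

section Exponents

theorem inv_toReal_conjExponent {p : ℝ≥0∞} (h : 1 ≤ p) :
    p.conjExponent.toReal⁻¹ = 1 - p.toReal⁻¹ := by
  have : p.HolderConjugate p.conjExponent := .conjExponent h
  have e := ENNReal.HolderConjugate.inv_add_inv_eq_one p p.conjExponent
  have e' := congrArg ENNReal.toReal e
  rw [ENNReal.toReal_add (by simpa using (zero_lt_one.trans_le h).ne')
    (by simp [ENNReal.conjExponent])] at e'
  simp only [ENNReal.toReal_inv, ENNReal.toReal_one] at e'
  linarith

theorem InterpExponent.of_real {θ : ℝ} {q₀ q₁ q : ℝ≥0∞} (h0 : 0 < θ) (h1 : θ < 1) (hq₀ : 1 ≤ q₀)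
    (hq₁ : 1 ≤ q₁) (hq : 1 ≤ q)
    (h : q.toReal⁻¹ = (1 - θ) * q₀.toReal⁻¹ + θ * q₁.toReal⁻¹) : InterpExponent θ q₀ q₁ q := by
  refine ⟨h0, h1, hq₀, hq₁, ?_⟩
  have inv : ∀ r : ℝ≥0∞, 1 ≤ r → r⁻¹ = ENNReal.ofReal r.toReal⁻¹ := fun r hr => by
    rw [← ENNReal.toReal_inv, ENNReal.ofReal_toReal]
    simpa using (zero_lt_one.trans_le hr).ne'
  have h1' : 0 ≤ 1 - θ := sub_nonneg.2 h1.le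
  rw [one_div, div_eq_mul_inv, div_eq_mul_inv, inv q hq, inv q₀ hq₀, inv q₁ hq₁,
    ← ENNReal.ofReal_mul h1', ← ENNReal.ofReal_mul h0.le, ← ENNReal.ofReal_add (by positivity)
    (by positivity), h]

theorem lt_one_of_lt_min {p r θ : ℝ≥0∞} (hp : 1 < p) (hpt : p < ∞) (hr : 1 < r) (hrt : r < ∞)
    (h : θ < min (p / r) (p.conjExponent / r.conjExponent)) :
    θ ≠ ∞ ∧ θ.toReal * p.toReal⁻¹ < r.toReal⁻¹ ∧
      θ.toReal * (1 - p.toReal⁻¹) < 1 - r.toReal⁻¹ := by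
  have hθt : θ ≠ ∞ := ne_top_of_lt h
  have hp0 : 1 < p.toReal := by simpa using (ENNReal.toReal_lt_toReal (by simp) hpt.ne).2 hp
  have hr0 : 1 < r.toReal := by simpa using (ENNReal.toReal_lt_toReal (by simp) hrt.ne).2 hr
  have hp1 : 0 < 1 - p.toReal⁻¹ := sub_pos.2 (inv_lt_one_of_one_lt₀ hp0)
  have hr1 : 0 < 1 - r.toReal⁻¹ := sub_pos.2 (inv_lt_one_of_one_lt₀ hr0)
  have hpc : p.conjExponent ≠ ∞ := by
    simp [ENNReal.conjExponent, (tsub_pos_of_lt hp).ne']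
  have hrc0 : r.conjExponent ≠ 0 := by simp [ENNReal.conjExponent]
  refine ⟨hθt, ?_, ?_⟩
  · have := (ENNReal.toReal_lt_toReal hθt (ENNReal.div_ne_top hpt.ne
      (zero_lt_one.trans hr).ne')).2 (h.trans_le (min_le_left _ _))
    rw [ENNReal.toReal_div, lt_div_iff₀ (by positivity)] at this
    field_simp
    linarith
  · have := (ENNReal.toReal_lt_toReal hθt (ENNReal.div_ne_top hpc hrc0)).2
      (h.trans_le (min_le_right _ _))
    rw [ENNReal.toReal_div, ← inv_inv p.conjExponent.toReal, inv_toReal_conjExponent hp.le,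
      div_eq_mul_inv, inv_toReal_conjExponent hr.le, inv_mul_eq_div, lt_div_iff₀ hp1] at this
    exact this

/-- The exponent needed for extrapolation. -/
theorem exists_interpExponent {p r : ℝ≥0∞} {θ : ℝ} (hp : 1 < p) (hr : 1 < r)
    (h0 : 0 < θ) (h1 : θ * p.toReal⁻¹ < r.toReal⁻¹)
    (h2 : θ * (1 - p.toReal⁻¹) < 1 - r.toReal⁻¹) :
    θ < 1 ∧ ∃ r₁ : ℝ≥0∞, 1 < r₁ ∧ r₁ < ∞ ∧ InterpExponent θ r₁ p r := by
  have hθ1 : θ < 1 := by linarith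
  have hθ' : 0 < 1 - θ := sub_pos.2 hθ1
  -- This is `1/r₁`, solved from `1/r = (1-θ)/r₁ + θ/p`. The two hypotheses say `ρ > 0` and `ρ < 1`;
  -- their sum says `θ < 1`.
  set ρ := (r.toReal⁻¹ - θ * p.toReal⁻¹) / (1 - θ) with hρ
  have hρ0 : 0 < ρ := div_pos (sub_pos.2 h1) hθ'
  have hρ1 : ρ < 1 := by rw [hρ, div_lt_one hθ']; linarith
  have hr₁ : 1 < ENNReal.ofReal ρ⁻¹ := by
    rw [← ENNReal.ofReal_one]
    exact (ENNReal.ofReal_lt_ofReal_iff (inv_pos.2 hρ0)).2 (one_lt_inv₀ hρ0 |>.2 hρ1)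
  refine ⟨hθ1, ENNReal.ofReal ρ⁻¹, hr₁, ENNReal.ofReal_lt_top,
    .of_real h0 hθ1 hr₁.le hp.le hr.le ?_⟩
  rw [ENNReal.toReal_ofReal (inv_pos.2 hρ0).le, inv_inv, hρ, mul_div_cancel₀ _ hθ'.ne']
  ring

end Exponents

/-! ### Extrapolation from the trivial endpoints. -/

section Extrapolation

open InterpolationCouple

variable {X : Type*} [NormedAddCommGroup X] [NormedSpace ℂ X] {p q s r θ : ℝ≥0∞}

theorem HasUpperDecompositions.extrapolate (hX : IsUMD X) (hp : 1 < p) (hpt : p < ∞) (hq : 1 < q)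
    (hqt : q < ∞) (h : HasUpperDecompositions X q p) (hs : 1 ≤ s) (hsq : s < q) (hr : 1 < r)
    (hrt : r < ∞) (hθ : θ < min (p / r) (p.conjExponent / r.conjExponent))
    (hsθ : s.conjExponent = q.conjExponent / θ) : HasUpperDecompositions X s r := by
  obtain ⟨hθt, h1, h2⟩ := lt_one_of_lt_min hp hpt hr hrt hθ
  -- The relation `s' = q'/θ` amounts to `1/s = (1-θ)/1 + θ/q`, interpolation between `ℓ^1` and
  -- `ℓ^q`.
  have hs' : 1 - s.toReal⁻¹ = θ.toReal * (1 - q.toReal⁻¹) := by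
    rw [← inv_toReal_conjExponent hs, hsθ, ENNReal.toReal_div, inv_div, div_eq_mul_inv,
      inv_toReal_conjExponent hq.le]
  have hst : s ≠ ∞ := (hsq.trans hqt).ne
  rcases (ENNReal.toReal_nonneg (a := θ)).eq_or_lt with h0 | h0
  · have e : s = 1 := by
      rw [← h0, zero_mul, sub_eq_zero, eq_comm, inv_eq_one] at hs'
      rw [← ENNReal.toReal_eq_toReal_iff' hst ENNReal.one_ne_top, hs', ENNReal.toReal_one]
    rw [e]
    exact hasUpperDecompositions_one hr.le
  · obtain ⟨hθ1, r₁, hr₁, hr₁t, hexp⟩ := exists_interpExponent hp hr h0 h1 h2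
    have hexq : InterpExponent θ.toReal 1 q s := .of_real h0 hθ1 le_rfl hq.le hs (by
      rw [ENNReal.toReal_one, inv_one]; linarith)
    exact .of_isometry (diagIsometry X ⟨θ.toReal, h0, hθ1⟩)
      ((diag X).hasUpperDecompositions hX hX hexp hr₁ hp hr₁t hpt hexq
        (hasUpperDecompositions_one hr₁.le) h)

theorem HasLowerDecompositions.extrapolate (hX : IsUMD X) (hp : 1 < p) (hpt : p < ∞) (hq : 1 < q)
    (h : HasLowerDecompositions X q p) (hsq : q < s) (hr : 1 < r)
    (hrt : r < ∞) (hθ : θ < min (p / r) (p.conjExponent / r.conjExponent))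
    (hsθ : s = q / θ) : HasLowerDecompositions X s r := by
  obtain ⟨hθt, h1, h2⟩ := lt_one_of_lt_min hp hpt hr hrt hθ
  rcases eq_or_ne θ 0 with h0 | h0
  · have e : s = ∞ := by rw [hsθ, h0, ENNReal.div_zero (zero_lt_one.trans hq).ne']
    rw [e]
    exact hX.hasLowerDecompositions_top hr hrt
  · obtain ⟨hθ1, r₁, hr₁, hr₁t, hexp⟩ := exists_interpExponent hp hr
      (ENNReal.toReal_pos h0 hθt) h1 h2
    -- Here `s = q/θ` amounts to `1/s = (1-θ)/∞ + θ/q`.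
    have hexq : InterpExponent θ.toReal ∞ q s :=
      .of_real (ENNReal.toReal_pos h0 hθt) hθ1 le_top hq.le (hq.trans hsq).le (by
        rw [hsθ, ENNReal.toReal_div, ENNReal.toReal_top, inv_zero, inv_div, mul_zero, zero_add,
          div_eq_mul_inv])
    exact .of_isometry (diagIsometry X ⟨θ.toReal, ENNReal.toReal_pos h0 hθt, hθ1⟩)
      ((diag X).hasLowerDecompositions hexp hr₁t.ne hpt.ne hexq
        (hX.hasLowerDecompositions_top hr₁ hr₁t) h)

end Extrapolation

end

theorem proposition2p4 :
    -- interpolation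
    (∀ (X₀ : Type*) (X₁ : Type*) (V : Type*)
        [NormedAddCommGroup X₀] [NormedSpace ℂ X₀] [CompleteSpace X₀]
        [NormedAddCommGroup X₁] [NormedSpace ℂ X₁] [CompleteSpace X₁]
        [AddCommGroup V] [Module ℂ V] [TopologicalSpace V]
        [IsTopologicalAddGroup V] [ContinuousSMul ℂ V] [T2Space V]
        (c : InterpolationCouple X₀ X₁ V) (p₀ p₁ q₀ q₁ p q : ℝ≥0∞) (θ : Set.Ioo (0 : ℝ) 1),
        IsUMD X₀ → IsUMD X₁ →
        1 < p₀ → p₀ < ∞ → 1 < p₁ → p₁ < ∞ → 1 ≤ q₀ → 1 ≤ q₁ →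
        1 / p = ENNReal.ofReal (1 - θ) / p₀ + ENNReal.ofReal θ / p₁ →
        1 / q = ENNReal.ofReal (1 - θ) / q₀ + ENNReal.ofReal θ / q₁ →
        (HasUpperDecompositions X₀ q₀ p₀ → HasUpperDecompositions X₁ q₁ p₁ →
          HasUpperDecompositions (c.InterpSpace θ) q p) ∧
        (HasLowerDecompositions X₀ q₀ p₀ → HasLowerDecompositions X₁ q₁ p₁ →
          HasLowerDecompositions (c.InterpSpace θ) q p)) ∧
    -- extrapolation
    (∀ (X : Type*) [NormedAddCommGroup X] [NormedSpace ℂ X] [CompleteSpace X]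
        (p q : ℝ≥0∞), IsUMD X → 1 < p → p < ∞ → 1 < q → q < ∞ →
        (HasUpperDecompositions X q p →
          ∀ s r θ : ℝ≥0∞, 1 ≤ s → s < q → 1 < r → r < ∞ →
            θ < min (p / r) (p.conjExponent / r.conjExponent) →
            s.conjExponent = q.conjExponent / θ →
            HasUpperDecompositions X s r) ∧
        (HasLowerDecompositions X q p →
          ∀ s r θ : ℝ≥0∞, q < s → 1 < r → r < ∞ →
            θ < min (p / r) (p.conjExponent / r.conjExponent) →
            s = q / θ →
            HasLowerDecompositions X s r)) := by
  refine ⟨?_, ?_⟩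
  · intro X₀ X₁ V _ _ _ _ _ _ _ _ _ _ _ _ c p₀ p₁ q₀ q₁ p q θ hX₀ hX₁ hp₀ ht₀ hp₁ ht₁ hq₀ hq₁ hp hq
    have hexp : InterpExponent θ p₀ p₁ p := ⟨θ.2.1, θ.2.2, hp₀.le, hp₁.le, hp⟩
    have hexq : InterpExponent θ q₀ q₁ q := ⟨θ.2.1, θ.2.2, hq₀, hq₁, hq⟩
    exact ⟨fun h₀ h₁ => c.hasUpperDecompositions hX₀ hX₁ hexp hp₀ hp₁ ht₀ ht₁ hexq h₀ h₁,
      fun h₀ h₁ => c.hasLowerDecompositions hexp ht₀.ne ht₁.ne hexq h₀ h₁⟩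
  · intro X _ _ _ p q hX hp hpt hq hqt
    exact ⟨fun h s r θ hs hsq hr hrt hθ hsθ =>
        h.extrapolate hX hp hpt hq hqt hs hsq hr hrt hθ hsθ,
      fun h s r θ hsq hr hrt hθ hsθ => h.extrapolate hX hp hpt hq hsq hr hrt hθ hsθ⟩
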